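/- All rings are associative and unital, and all modules are unital. Let $G$ be a group and $A=\bigoplus_{g\in G}A_g$ a $G$-graded ring with $R:=A_1$. Assume that $A$ is epsilon-strongly graded, i.e. for each $g\in G$ the ideal $A_gA_{g^{-1}}$ of $R$ has an identity element $\epsilon_g$, and $\epsilon_g a=a=a\epsilon_{g^{-1}}$ for all $a\in A_g$. Assume that $R$ is semiperfect, and let $\mathcal E=\{e_1,\dots,e_n\}$ be a set of pairwise orthogonal primitive idempotents of $R$ such that $Re_1,\dots,Re_n$ is an irredundant set of representatives of the isomorphism classes of indecomposable projective left $R$-modules. Conventions. Let $B$ be a ring graded by a group $H$. For a graded left $B$-module $M$, $\operatorname{END}_B(M)=\bigoplus_{l\in H}\{f\in \operatorname{End}_B(M): f(M_h)\subseteq M_{hl}\ \forall h\in H\}$, an $H$-graded ring with product $uv=v\circ u$. Induced modules $A\otimes_R N$ are graded by $(A\otimes_R N)_g=A_g\otimes_R N$, and likewise for graded subrings of $A$ containing $R$. An $H$-graded ring $C$ is graded equivalent to $B$ if there is a graded left $B$-module $M$ that is a progenerator of $B$-modules with $\operatorname{END}_B(M)\simeq C$ as graded rings. An $H$-graded ring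 is a partial crossed product if it is isomorphic, as a graded ring, to $S\star_{\alpha,\omega}H=\bigoplus_{h\in H} D_h\delta_h$ for a unital twisted partial action $(\alpha,\omega)=(\{D_h\},\{\alpha_h\},\{\omega_{h,k}\})$ of $H$ on a ring $S$, where $D_h=S1_h$ with $1_h$ a (possibly zero) central idempotent and $(a\delta_h)(b\delta_k)=a\,\alpha_h(b1_{h^{-1}})\,\omega_{h,k}\,\delta_{hk}$. A left $R$-module $P$ is $G$-invariant if $A_g\otimes_R P\simeq P$ as left $R$-modules for every $g\in G$ with $A_g\ne 0$. An $R$-bimodule $P$ is partially invertible if it is finitely generated projective both as a left and as a right $R$-module and the maps $R\to\operatorname{End}(P_R)$, $a\mapsto(x\mapsto ax)$, and $R\to\operatorname{End}({}_RP)$, $a\mapsto(x\mapsto xa)$, are surjective. For a non-empty subset $\mathcal X\subseteq\mathcal E$, and also for $\mathcal X=\mathcal E$, put $$G_{\mathcal X}=\{g\in G:\ \forall e_i\in\mathcal X\ \exists e_j\in\mathcal X \text{ with } A_g\otimes_R Re_i\simeq Re_j \text{ as left } R\text{-modules}\},$$ $A_{G_{\mathcal X}}=\bigoplus_{g\in G_{\mathcal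 X}}A_g$ and $Q_{\mathcal X}=\bigoplus_{e_i\in\mathcal X}Re_i$. Then: (i) If $P$ is a $G$-invariant progenerator in the category of left $R$-modules, then $\operatorname{END}_A(A\otimes_R P)$ is a partial crossed product and $A$ is graded equivalent to it. (ii) If $P$ is a partially invertible $R$-bimodule and $1\le i\le n$, then either $P\otimes_R Re_i=0$ or $P\otimes_R Re_i\simeq Re_j$ as left $R$-modules for some $e_j\in\mathcal E$. (iii) For every non-empty $\mathcal X\subseteq\mathcal E$, $G_{\mathcal X}$ is a subgroup of $G$, the subring $A_{G_{\mathcal X}}$ of $A$ is epsilon-strongly $G_{\mathcal X}$-graded, and $\operatorname{END}_{A_{G_{\mathcal X}}}(A_{G_{\mathcal X}}\otimes_R Q_{\mathcal X})$ is a partial crossed product. (iv) $G_{\mathcal E}=\{g\in G:\epsilon_g e_i=e_i\ \forall e_i\in\mathcal E\}=\{g\in G:\epsilon_g e_i\neq 0\ \forall e_i\in\mathcal E\}$. (v) $G_{\mathcal E}$ is a subgroup of $G$, the subring $A_{G_{\mathcal E}}$ of $A$ is epsilon-strongly $G_{\mathcal E}$-graded, $\operatorname{END}_{A_{G_{\mathcal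 E}}}(A_{G_{\mathcal E}}\otimes_R Q_{\mathcal E})$ is a partial crossed product, and $A_{G_{\mathcal E}}$ is graded equivalent to it. -/

import Mathlib

open scoped TensorProduct DirectSum

universe u v w

noncomputable section

/-! ### Notions from module theory over a noncommutative ring -/

/-- A (unital, associative) ring `R` is semiperfect if `R / J(R)` is semisimple and idempotents
lift modulo the Jacobson radical `J(R)`. -/
structure IsSemiperfectRing (R : Type*) [Ring R] : Prop where
  isSemisimpleRing : IsSemisimpleRing (R ⧸ Ring.jacobson R)
  lift_idempotent : ∀ x : R ⧸ Ring.jacobson R, IsIdempotentElem x →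
    ∃ e : R, IsIdempotentElem e ∧ Ideal.Quotient.mk (Ring.jacobson R) e = x

/-- A nonzero idempotent is primitive if it is not a sum of two nonzero orthogonal idempotents. -/
structure IsPrimitiveIdempotent {R : Type*} [Ring R] (e : R) : Prop where
  idem : IsIdempotentElem e
  ne_zero : e ≠ 0
  eq_zero_or : ∀ f g : R, IsIdempotentElem f → IsIdempotentElem g → f * g = 0 → g * f = 0 →
    e = f + g → f = 0 ∨ g = 0

/-- A nonzero module is indecomposable if it has no nontrivial internal decomposition. -/
structure IsIndecomposableModule (R M : Type*) [Ring R] [AddCommGroup M] [Module R M] : Prop where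
  nontrivial : Nontrivial M
  eq_bot_or : ∀ U V : Submodule R M, IsCompl U V → U = ⊥ ∨ V = ⊥

/-- `M` is a progenerator in the category of left `R`-modules: finitely generated, projective, and
a generator, i.e. `R` is an epimorphic image of a finite direct power of `M`. -/
structure IsProgenerator (R M : Type*) [Ring R] [AddCommGroup M] [Module R M] : Prop where
  finite : Module.Finite R M
  projective : Module.Projective R M
  generator : ∃ (n : ℕ) (f : (Fin n → M) →ₗ[R] R), Function.Surjective f

/-- The left ideal `R e`, as a left `R`-module. -/
abbrev leftIdeal {R : Type*} [Ring R] (e : R) : Submodule R R := Submodule.span R {e}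

/-- `e₁, …, eₙ` are pairwise orthogonal primitive idempotents of `R` such that
`R e₁, …, R eₙ` is an irredundant set of representatives of the isomorphism classes of
indecomposable projective left `R`-modules. -/
structure IsBasicSet {R : Type u} [Ring R] {n : ℕ} (e : Fin n → R) : Prop where
  primitive : ∀ i, IsPrimitiveIdempotent (e i)
  orthogonal : ∀ i j, i ≠ j → e i * e j = 0
  irredundant : ∀ i j, Nonempty (leftIdeal (e i) ≃ₗ[R] leftIdeal (e j)) → i = j
  complete : ∀ (M : Type u) [AddCommGroup M] [Module R M], Module.Projective R M →
    IsIndecomposableModule R M → ∃ i, Nonempty (M ≃ₗ[R] leftIdeal (e i))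

/-- For an `R`-bimodule `P` (right actions are actions of `Rᵐᵒᵖ`): `P` is partially invertible,
i.e. its isomorphism class belongs to the Picard semigroup of `R`. -/
structure IsPartiallyInvertible (R P : Type*) [Ring R] [AddCommGroup P] [Module R P]
    [Module Rᵐᵒᵖ P] [SMulCommClass R Rᵐᵒᵖ P] : Prop where
  finite_left : Module.Finite R P
  projective_left : Module.Projective R P
  finite_right : Module.Finite Rᵐᵒᵖ P
  projective_right : Module.Projective Rᵐᵒᵖ P
  /-- `l : R → End(P_R)`, `l(a)(x) = a x`, is onto. -/
  left_surjective : ∀ f : P →ₗ[Rᵐᵒᵖ] P, ∃ a : R, ∀ x : P, f x = a • x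
  /-- `r : R → End(_R P)`, `r(a)(x) = x a`, is onto. -/
  right_surjective : ∀ f : P →ₗ[R] P, ∃ a : R, ∀ x : P, f x = MulOpposite.op a • x

/-! ### Tensor products over a noncommutative ring -/

section BimoduleTensor

variable (S R P M : Type*) [Ring S] [Ring R] [AddCommGroup P] [AddCommGroup M]
  [Module S P] [Module Rᵐᵒᵖ P] [SMulCommClass S Rᵐᵒᵖ P] [Module R M]

/-- The elements `(p r) ⊗ m - p ⊗ (r m)` of `P ⊗_ℤ M`. -/
def balancingRelations : Set (P ⊗[ℤ] M) :=
  {x | ∃ (p : P) (r : R) (m : M), x = (MulOpposite.op r • p) ⊗ₜ[ℤ] m - p ⊗ₜ[ℤ] (r • m)}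

/-- The additive subgroup generated by the balancing relations; it is an `S`-submodule. -/
def balancingSubmodule : Submodule S (P ⊗[ℤ] M) :=
  { AddSubgroup.closure (balancingRelations R P M) with
    smul_mem' := by
      intro s x hx
      change s • x ∈ AddSubgroup.closure (balancingRelations R P M)
      change x ∈ AddSubgroup.closure (balancingRelations R P M) at hx
      induction hx using AddSubgroup.closure_induction with
      | mem x hx =>
        obtain ⟨p, r, m, rfl⟩ := hx
        refine AddSubgroup.subset_closure ⟨s • p, r, m, ?_⟩
        rw [smul_sub, TensorProduct.smul_tmul', TensorProduct.smul_tmul', smul_comm]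
      | zero => rw [smul_zero]; exact zero_mem _
      | add x y _ _ hx hy => rw [smul_add]; exact add_mem hx hy
      | neg x _ hx => rw [smul_neg]; exact neg_mem hx }

/-- For an `(S, R)`-bimodule `P` and a left `R`-module `M`, the left `S`-module `P ⊗_R M`. -/
abbrev BimoduleTensor : Type _ := (P ⊗[ℤ] M) ⧸ balancingSubmodule S R P M

variable {P M} in
/-- The pure tensor `p ⊗ m` in `P ⊗_R M`. -/
def bimoduleTmul (p : P) (m : M) : BimoduleTensor S R P M :=
  (balancingSubmodule S R P M).mkQ (p ⊗ₜ[ℤ] m)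

/-- An additive endomorphism of `P` commuting with the right action of `R` acts on `P ⊗_R M`. -/
theorem exists_bimoduleTensor_map (p : P →+ P)
    (hp : ∀ (r : R) (a : P), p (MulOpposite.op r • a) = MulOpposite.op r • p a) :
    ∃ π : BimoduleTensor S R P M →+ BimoduleTensor S R P M,
      ∀ a m, π (bimoduleTmul S R a m) = bimoduleTmul S R (p a) m := by
  let T : (P ⊗[ℤ] M) →ₗ[ℤ] (P ⊗[ℤ] M) :=
    TensorProduct.map p.toIntLinearMap (LinearMap.id : M →ₗ[ℤ] M)
  have hT : ∀ (a : P) (m : M), T (a ⊗ₜ[ℤ] m) = p a ⊗ₜ[ℤ] m := fun _ _ => rfl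
  let F : (P ⊗[ℤ] M) →+ BimoduleTensor S R P M :=
    (balancingSubmodule S R P M).mkQ.toAddMonoidHom.comp T.toAddMonoidHom
  have hF : (balancingSubmodule S R P M).toAddSubgroup ≤ F.ker := by
    change AddSubgroup.closure (balancingRelations R P M) ≤ F.ker
    rw [AddSubgroup.closure_le]
    rintro _ ⟨a, r, m, rfl⟩
    change (balancingSubmodule S R P M).mkQ _ = 0
    rw [Submodule.mkQ_apply, Submodule.Quotient.mk_eq_zero]
    refine AddSubgroup.subset_closure ⟨p a, r, m, ?_⟩
    rw [LinearMap.toAddMonoidHom_coe, map_sub, hT, hT, hp]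
  exact ⟨QuotientAddGroup.lift (balancingSubmodule S R P M).toAddSubgroup F hF,
    fun _ _ => rfl⟩

end BimoduleTensor

/-! ### Graded rings and graded modules -/

/-- A `G`-grading of the ring `A`: additive subgroups `A_g` with `A = ⨁ A_g` and
`A_g A_h ⊆ A_{gh}` (so that `1 ∈ A_1`). -/
structure RingGrading (G A : Type*) [Group G] [Ring A] where
  comp : G → AddSubgroup A
  one_mem : (1 : A) ∈ comp 1
  mul_mem : ∀ {g h : G} {a b : A}, a ∈ comp g → b ∈ comp h → a * b ∈ comp (g * h)
  indep : iSupIndep comp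
  iSup_eq_top : ⨆ g, comp g = ⊤

/-- A `G`-grading of the left `A`-module `M`, where `A` is a `G`-graded ring. -/
structure ModuleGrading {G A : Type*} [Group G] [Ring A] (𝒜 : RingGrading G A)
    (M : Type*) [AddCommGroup M] [Module A M] where
  comp : G → AddSubgroup M
  smul_mem : ∀ {g h : G} {a : A} {m : M}, a ∈ 𝒜.comp g → m ∈ comp h → a • m ∈ comp (g * h)
  indep : iSupIndep comp
  iSup_eq_top : ⨆ g, comp g = ⊤

/-- Two rings with families of homogeneous components are isomorphic as graded rings. -/
def GradedRingIso {G B C : Type*} [AddGroup B] [Mul B] [AddGroup C] [Mul C]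
    (ℬ : G → AddSubgroup B) (𝒞 : G → AddSubgroup C) : Prop :=
  ∃ φ : B ≃+* C, ∀ (g : G) (b : B), b ∈ ℬ g ↔ φ b ∈ 𝒞 g

/-- The additive subgroup `X Y` of finite sums of products `x y`. -/
def addSubgroupMul {A : Type*} [Ring A] (X Y : AddSubgroup A) : AddSubgroup A :=
  AddSubgroup.closure {z | ∃ x ∈ X, ∃ y ∈ Y, z = x * y}

namespace RingGrading

variable {G A : Type*} [Group G] [Ring A] (𝒜 : RingGrading G A)

/-- The ring `A` is epsilon-strongly graded, and `ε g` is the identity element of `A_g A_{g⁻¹}`: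
`A_g A_{g⁻¹}` is a unital ideal of `A_1` with identity `ε g`, and `A_g` is a unital
`(A_g A_{g⁻¹}, A_{g⁻¹} A_g)`-bimodule. -/
structure IsEpsilonStrong (ε : G → A) : Prop where
  mem : ∀ g, ε g ∈ addSubgroupMul (𝒜.comp g) (𝒜.comp g⁻¹)
  identity : ∀ g, ∀ x ∈ addSubgroupMul (𝒜.comp g) (𝒜.comp g⁻¹), ε g * x = x ∧ x * ε g = x
  left_unital : ∀ g, ∀ a ∈ 𝒜.comp g, ε g * a = a
  right_unital : ∀ g, ∀ a ∈ 𝒜.comp g, a * ε g⁻¹ = a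

/-- The support `{g | A_g ≠ 0}`. -/
def support : Set G := {g | 𝒜.comp g ≠ ⊥}

/-- The ring `R = A_1`. -/
def base : Subring A :=
  { 𝒜.comp 1 with
    one_mem' := 𝒜.one_mem
    mul_mem' := fun {a b} ha hb => by
      have h := 𝒜.mul_mem (g := 1) (h := 1) ha hb
      rwa [one_mul] at h }

/-- The subring `A_H = ⨁_{h ∈ H} A_h` of `A`, for a subgroup `H` of `G`. -/
def sub (H : Subgroup G) : Subring A :=
  { (⨆ h : H, 𝒜.comp h : AddSubgroup A) with
    one_mem' := AddSubgroup.mem_iSup_of_mem (1 : H) 𝒜.one_mem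
    mul_mem' := fun {a b} ha hb => by
      change a * b ∈ (⨆ h : H, 𝒜.comp h : AddSubgroup A)
      change a ∈ (⨆ h : H, 𝒜.comp h : AddSubgroup A) at ha
      change b ∈ (⨆ h : H, 𝒜.comp h : AddSubgroup A) at hb
      induction ha using AddSubgroup.iSup_induction' with
      | h1 => rw [zero_mul]; exact zero_mem _
      | hadd x y _ _ hx hy => rw [add_mul]; exact add_mem hx hy
      | hp g x hx =>
        induction hb using AddSubgroup.iSup_induction' with
        | h1 => rw [mul_zero]; exact zero_mem _
        | hadd y z _ _ hy hz => rw [mul_add]; exact add_mem hy hz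
        | hp h y hy => exact AddSubgroup.mem_iSup_of_mem (g * h) (𝒜.mul_mem hx hy) }

theorem comp_le_sub (H : Subgroup G) (h : H) {a : A} (ha : a ∈ 𝒜.comp h) : a ∈ 𝒜.sub H :=
  (AddSubgroup.mem_iSup_of_mem (S := fun h : H => 𝒜.comp h) h ha :
    a ∈ (⨆ h : H, 𝒜.comp h : AddSubgroup A))

theorem base_le_sub (H : Subgroup G) : 𝒜.base ≤ 𝒜.sub H :=
  fun _ ha => 𝒜.comp_le_sub H 1 ha

/-- The `H`-grading of `A_H` with components `A_h`. -/
def restrict (H : Subgroup G) : RingGrading H (𝒜.sub H) where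
  comp h := (𝒜.comp h).comap (𝒜.sub H).subtype.toAddMonoidHom
  one_mem := 𝒜.one_mem
  mul_mem ha hb := 𝒜.mul_mem ha hb
  indep := by
    intro h
    rw [AddSubgroup.disjoint_def]
    intro x hx hx'
    have h1 : (x : A) ∈ ⨆ g, ⨆ (_ : g ≠ (h : G)), 𝒜.comp g := by
      have h2 : (⨆ k, ⨆ (_ : k ≠ h),
          (𝒜.comp (k : H)).comap (𝒜.sub H).subtype.toAddMonoidHom) ≤
          (⨆ g, ⨆ (_ : g ≠ (h : G)), 𝒜.comp g).comap (𝒜.sub H).subtype.toAddMonoidHom := by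
        refine iSup₂_le fun k hk => AddSubgroup.comap_mono ?_
        exact le_iSup₂_of_le (k : G) (fun h' => hk (Subtype.ext h')) le_rfl
      exact h2 hx'
    exact Subtype.ext (AddSubgroup.disjoint_def.mp (𝒜.indep (h : G)) hx h1)
  iSup_eq_top := by
    rw [eq_top_iff]
    rintro ⟨x, hx⟩ -
    have key : ∀ y : A, y ∈ (⨆ h : H, 𝒜.comp h : AddSubgroup A) → ∀ hy : y ∈ 𝒜.sub H,
        (⟨y, hy⟩ : 𝒜.sub H) ∈
          ⨆ h : H, (𝒜.comp h).comap (𝒜.sub H).subtype.toAddMonoidHom := by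
      intro y hy'
      induction hy' using AddSubgroup.iSup_induction' with
      | h1 => intro hy; exact zero_mem _
      | hadd y z hy hz ihy ihz => intro _; exact add_mem (ihy hy) (ihz hz)
      | hp h y hy => intro hy'; exact AddSubgroup.mem_iSup_of_mem h hy
    exact key x hx hx

/-! #### The bimodule structures -/

/-- Right multiplication of `A_1` on `A`. -/
instance rightModule : Module (𝒜.base)ᵐᵒᵖ A :=
  Module.compHom A (RingHom.op 𝒜.base.subtype)

theorem op_smul_eq (r : 𝒜.base) (a : A) : MulOpposite.op r • a = a * (r : A) := rfl

instance smulCommClass_right : SMulCommClass A (𝒜.base)ᵐᵒᵖ A where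
  smul_comm a r b := by
    induction r using MulOpposite.rec' with
    | _ r => simp only [op_smul_eq, smul_eq_mul, mul_assoc]

/-- Right multiplication of `A_1` on `A_H`. -/
instance rightModuleSub (H : Subgroup G) : Module (𝒜.base)ᵐᵒᵖ (𝒜.sub H) :=
  Module.compHom (𝒜.sub H) (RingHom.op (Subring.inclusion (𝒜.base_le_sub H)))

theorem coe_op_smul_sub (H : Subgroup G) (r : 𝒜.base) (a : 𝒜.sub H) :
    ((MulOpposite.op r • a : 𝒜.sub H) : A) = (a : A) * (r : A) := rfl

instance smulCommClass_rightSub (H : Subgroup G) :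
    SMulCommClass (𝒜.sub H) (𝒜.base)ᵐᵒᵖ (𝒜.sub H) where
  smul_comm a r b := by
    induction r using MulOpposite.rec' with
    | _ r =>
      apply Subtype.ext
      simp only [coe_op_smul_sub, smul_eq_mul, Subring.coe_mul, mul_assoc]

/-- Left multiplication of `A_1` on `A_g`. -/
instance compModule (g : G) : Module 𝒜.base (𝒜.comp g) where
  smul r a := ⟨(r : A) * (a : A), by
    have h := 𝒜.mul_mem (g := 1) (h := g) r.2 a.2
    rwa [one_mul] at h⟩
  one_smul a := Subtype.ext (one_mul (a : A))
  mul_smul r s a := Subtype.ext (mul_assoc (r : A) s a)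
  smul_zero r := Subtype.ext (mul_zero (r : A))
  smul_add r a b := Subtype.ext (mul_add (r : A) a b)
  add_smul r s a := Subtype.ext (add_mul (r : A) s a)
  zero_smul a := Subtype.ext (zero_mul (a : A))

/-- Right multiplication of `A_1` on `A_g`. -/
instance compRightModule (g : G) : Module (𝒜.base)ᵐᵒᵖ (𝒜.comp g) where
  smul r a := ⟨(a : A) * (r.unop : A), by
    have h := 𝒜.mul_mem (g := g) (h := 1) a.2 r.unop.2
    rwa [mul_one] at h⟩
  one_smul a := Subtype.ext (mul_one (a : A))
  mul_smul r s a := Subtype.ext (mul_assoc (a : A) s.unop r.unop).symm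
  smul_zero r := Subtype.ext (zero_mul (r.unop : A))
  smul_add r a b := Subtype.ext (add_mul (a : A) b r.unop)
  add_smul r s a := Subtype.ext (mul_add (a : A) r.unop s.unop)
  zero_smul a := Subtype.ext (mul_zero (a : A))

instance compSMulCommClass (g : G) : SMulCommClass 𝒜.base (𝒜.base)ᵐᵒᵖ (𝒜.comp g) where
  smul_comm r s a := Subtype.ext (mul_assoc (r : A) (a : A) (s.unop : A)).symm

/-- The left `A_1`-module `A_g ⊗_{A_1} M`. -/
abbrev compTensor (g : G) (M : Type*) [AddCommGroup M] [Module 𝒜.base M] : Type _ :=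
  BimoduleTensor 𝒜.base 𝒜.base (𝒜.comp g) M

/-- A left `A_1`-module `M` is `G`-invariant if `A_g ⊗_{A_1} M ≃ M` for all `g` in the support. -/
def IsInvariantModule (M : Type*) [AddCommGroup M] [Module 𝒜.base M] : Prop :=
  ∀ g ∈ 𝒜.support, Nonempty (𝒜.compTensor g M ≃ₗ[𝒜.base] M)

/-- `G_X`: the set of all `g` such that for every `i ∈ X` there is `j ∈ X` with
`A_g ⊗_R R e_i ≃ R e_j`, where `R = A_1`. -/
def stableSet {n : ℕ} (e : Fin n → 𝒜.base) (X : Set (Fin n)) : Set G :=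
  {g | ∀ i ∈ X, ∃ j ∈ X,
    Nonempty (𝒜.compTensor g (leftIdeal (e i)) ≃ₗ[𝒜.base] leftIdeal (e j))}

end RingGrading

/-- `Q_X = ⨁_{i ∈ X} R e_i`. -/
abbrev sumLeftIdeals {R : Type*} [Ring R] {n : ℕ} (e : Fin n → R) (X : Set (Fin n)) : Type _ :=
  ⨁ i : X, leftIdeal (e i)

/-! ### The induced graded module -/

/-- `R` acts on the right of the graded ring `A` by maps preserving the homogeneous components. -/
class RightStable {G A : Type*} [Group G] [Ring A] (𝒜 : RingGrading G A) (R : Type*) [Ring R]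
    [Module Rᵐᵒᵖ A] : Prop where
  smul_mem : ∀ (g : G) (r : R) (a : A), a ∈ 𝒜.comp g → MulOpposite.op r • a ∈ 𝒜.comp g

instance {G A : Type*} [Group G] [Ring A] (𝒜 : RingGrading G A) : RightStable 𝒜 𝒜.base where
  smul_mem g r a ha := by
    have h := 𝒜.mul_mem (g := g) (h := 1) ha r.2
    rwa [mul_one] at h

instance {G A : Type*} [Group G] [Ring A] (𝒜 : RingGrading G A) (H : Subgroup G) :
    RightStable (𝒜.restrict H) 𝒜.base where
  smul_mem g r a ha := by
    have h := 𝒜.mul_mem (g := (g : G)) (h := 1) (a := (a : A)) ha r.2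
    rw [mul_one] at h
    exact h

section Induced

variable {G A : Type*} [Group G] [Ring A] (𝒜 : RingGrading G A) (R M : Type*) [Ring R]
  [Module Rᵐᵒᵖ A] [SMulCommClass A Rᵐᵒᵖ A] [RightStable 𝒜 R] [AddCommGroup M] [Module R M]

/-- The component `A_g ⊗_R M` of `A ⊗_R M`. -/
def inducedComp (g : G) : AddSubgroup (BimoduleTensor A R A M) :=
  AddSubgroup.closure {x | ∃ a ∈ 𝒜.comp g, ∃ m : M, x = bimoduleTmul A R a m}
theorem exists_projection {ι N : Type*} [AddCommGroup N] (C : ι → AddSubgroup N)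
    (hi : iSupIndep C) (ht : ⨆ i, C i = ⊤) (i : ι) :
    ∃ π : N →+ N, (∀ x ∈ C i, π x = x) ∧ ∀ j, j ≠ i → ∀ x ∈ C j, π x = 0 := by
  have hc : IsCompl (C i) (⨆ j, ⨆ (_ : j ≠ i), C j) := by
    refine ⟨hi i, codisjoint_iff_le_sup.mpr ?_⟩
    rw [← ht]
    refine iSup_le fun j => ?_
    by_cases hj : j = i
    · subst hj; exact le_sup_left
    · exact le_sup_of_le_right (le_iSup₂_of_le j hj le_rfl)
  have hc' := AddSubgroup.toIntSubmodule.isCompl hc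
  refine ⟨((Submodule.subtype _).comp (Submodule.projectionOnto _ _ hc')).toAddMonoidHom,
    fun x hx => ?_, fun j hj x hx => ?_⟩
  · exact congrArg Subtype.val (Submodule.projectionOnto_apply_left hc' ⟨x, hx⟩)
  · have h : x ∈ AddSubgroup.toIntSubmodule (⨆ j, ⨆ (_ : j ≠ i), C j) :=
      (le_iSup₂_of_le (f := fun j (_ : j ≠ i) => C j) j hj le_rfl) hx
    exact congrArg Subtype.val (Submodule.projectionOnto_apply_right hc' ⟨x, h⟩)

theorem iSupIndep_of_projections {ι N : Type*} [AddCommGroup N] (C : ι → AddSubgroup N)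
    (h : ∀ i, ∃ π : N →+ N, (∀ x ∈ C i, π x = x) ∧ ∀ j, j ≠ i → ∀ x ∈ C j, π x = 0) :
    iSupIndep C := by
  intro i
  obtain ⟨π, h1, h2⟩ := h i
  rw [AddSubgroup.disjoint_def]
  intro x hx hx'
  have h3 : (⨆ j, ⨆ (_ : j ≠ i), C j) ≤ π.ker := iSup₂_le fun j hj y hy => h2 j hj y hy
  rw [← h1 x hx]
  exact h3 hx'

theorem exists_inducedProjection (g : G) :
    ∃ π : BimoduleTensor A R A M →+ BimoduleTensor A R A M,
      (∀ x ∈ inducedComp 𝒜 R M g, π x = x) ∧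
        ∀ h, h ≠ g → ∀ x ∈ inducedComp 𝒜 R M h, π x = 0 := by
  obtain ⟨p, hp1, hp2⟩ := exists_projection 𝒜.comp 𝒜.indep 𝒜.iSup_eq_top g
  have hp : ∀ (r : R) (a : A), p (MulOpposite.op r • a) = MulOpposite.op r • p a := by
    intro r a
    have ha : a ∈ ⨆ k, 𝒜.comp k := by rw [𝒜.iSup_eq_top]; trivial
    induction ha using AddSubgroup.iSup_induction' with
    | h1 => simp
    | hadd x y _ _ hx hy => rw [smul_add, map_add, map_add, smul_add, hx, hy]
    | hp k x hx =>
      have hx' := RightStable.smul_mem (𝒜 := 𝒜) k r x hx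
      by_cases hk : k = g
      · subst hk; rw [hp1 _ hx, hp1 _ hx']
      · rw [hp2 k hk _ hx, hp2 k hk _ hx', smul_zero]
  obtain ⟨π, hπ⟩ := exists_bimoduleTensor_map A R A M p hp
  refine ⟨π, fun x hx => ?_, fun h hh x hx => ?_⟩
  · have : inducedComp 𝒜 R M g ≤ AddMonoidHom.eqLocus π (AddMonoidHom.id _) := by
      refine (AddSubgroup.closure_le _).mpr ?_
      rintro _ ⟨a, ha, m, rfl⟩
      change π _ = _
      rw [hπ, hp1 a ha]; rfl
    exact this hx
  · have : inducedComp 𝒜 R M h ≤ π.ker := by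
      refine (AddSubgroup.closure_le _).mpr ?_
      rintro _ ⟨a, ha, m, rfl⟩
      change π _ = _
      rw [hπ, hp2 h hh a ha, bimoduleTmul, TensorProduct.zero_tmul, map_zero]
    exact this hx

/-- The graded left `A`-module `A ⊗_R M` induced by the left `R`-module `M`. -/
def inducedGrading : ModuleGrading 𝒜 (BimoduleTensor A R A M) where
  comp := inducedComp 𝒜 R M
  smul_mem := by
    intro g h a x ha hx
    change x ∈ AddSubgroup.closure _ at hx
    induction hx using AddSubgroup.closure_induction with
    | zero => rw [smul_zero]; exact zero_mem _
    | add x y _ _ hx hy => rw [smul_add]; exact add_mem hx hy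
    | neg x _ hx => rw [smul_neg]; exact neg_mem hx
    | mem x hx =>
      obtain ⟨b, hb, m, rfl⟩ := hx
      exact AddSubgroup.subset_closure ⟨a * b, 𝒜.mul_mem ha hb, m, rfl⟩
  indep := iSupIndep_of_projections _ (exists_inducedProjection 𝒜 R M)
  iSup_eq_top := by
    rw [eq_top_iff]
    rintro x -
    obtain ⟨y, rfl⟩ := (balancingSubmodule A R A M).mkQ_surjective x
    induction y using TensorProduct.induction_on with
    | zero => rw [map_zero]; exact zero_mem _
    | add x y hx hy => rw [map_add]; exact add_mem hx hy
    | tmul a m =>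
      change bimoduleTmul A R a m ∈ _
      have ha : a ∈ ⨆ k, 𝒜.comp k := by rw [𝒜.iSup_eq_top]; trivial
      induction ha using AddSubgroup.iSup_induction' with
      | h1 => rw [bimoduleTmul, TensorProduct.zero_tmul, map_zero]; exact zero_mem _
      | hadd x y _ _ hx hy =>
        rw [bimoduleTmul, TensorProduct.add_tmul, map_add]; exact add_mem hx hy
      | hp k x hx =>
        exact AddSubgroup.mem_iSup_of_mem k (AddSubgroup.subset_closure ⟨x, hx, m, rfl⟩)

end Induced

/-! ### The graded endomorphism ring -/

namespace ModuleGrading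

variable {G A M : Type*} [Group G] [Ring A] {𝒜 : RingGrading G A} [AddCommGroup M] [Module A M]
  (ℳ : ModuleGrading 𝒜 M)

/-- The `A`-endomorphisms `f` of degree `l`, i.e. `f(M_g) ⊆ M_{gl}` for all `g`. They are viewed
in the opposite of the endomorphism ring, because the product is `u v = v ∘ u`. -/
def degreeEnd (l : G) : AddSubgroup (Module.End A M)ᵐᵒᵖ where
  carrier := {f | ∀ (g : G), ∀ m ∈ ℳ.comp g, f.unop m ∈ ℳ.comp (g * l)}
  zero_mem' := fun g _ _ => zero_mem (ℳ.comp (g * l))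
  add_mem' := fun hf hf' g m hm => add_mem (hf g m hm) (hf' g m hm)
  neg_mem' := fun hf g m hm => neg_mem (hf g m hm)

/-- The ring `END_A(M) = ⨁_l Mor_A(M, M)_l` with product `u v = v ∘ u`. -/
def endRing : Subring (Module.End A M)ᵐᵒᵖ :=
  { (⨆ l, ℳ.degreeEnd l : AddSubgroup (Module.End A M)ᵐᵒᵖ) with
    one_mem' := AddSubgroup.mem_iSup_of_mem 1 (fun g m hm => by rw [mul_one]; exact hm)
    mul_mem' := fun {a b} ha hb => by
      change a * b ∈ (⨆ l, ℳ.degreeEnd l : AddSubgroup _)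
      change a ∈ (⨆ l, ℳ.degreeEnd l : AddSubgroup _) at ha
      change b ∈ (⨆ l, ℳ.degreeEnd l : AddSubgroup _) at hb
      induction ha using AddSubgroup.iSup_induction' with
      | h1 => rw [zero_mul]; exact zero_mem _
      | hadd x y _ _ hx hy => rw [add_mul]; exact add_mem hx hy
      | hp k x hx =>
        induction hb using AddSubgroup.iSup_induction' with
        | h1 => rw [mul_zero]; exact zero_mem _
        | hadd y z _ _ hy hz => rw [mul_add]; exact add_mem hy hz
        | hp l y hy =>
          refine AddSubgroup.mem_iSup_of_mem (k * l) fun g m hm => ?_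
          rw [← mul_assoc]
          exact hy _ _ (hx g m hm) }

theorem degreeEnd_indep : iSupIndep ℳ.degreeEnd := by
  intro l
  rw [AddSubgroup.disjoint_def]
  intro f hf hf'
  apply MulOpposite.unop_injective
  ext m
  have hm : m ∈ ⨆ g, ℳ.comp g := by rw [ℳ.iSup_eq_top]; trivial
  change f.unop m = 0
  induction hm using AddSubgroup.iSup_induction' with
  | h1 => rw [map_zero]
  | hadd x y _ _ hx hy => rw [map_add, hx, hy, add_zero]
  | hp g m hm =>
    let ev : (Module.End A M)ᵐᵒᵖ →+ M :=
      { toFun := fun f => f.unop m, map_zero' := rfl, map_add' := fun _ _ => rfl }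
    have h1 : (⨆ k, ⨆ (_ : k ≠ l), ℳ.degreeEnd k) ≤
        (⨆ k, ⨆ (_ : k ≠ g * l), ℳ.comp k).comap ev := by
      refine iSup₂_le fun k hk f hf => ?_
      exact (le_iSup₂_of_le (f := fun k (_ : k ≠ g * l) => ℳ.comp k) (g * k)
        (fun h => hk (mul_left_cancel h)) le_rfl) (hf g m hm)
    exact AddSubgroup.disjoint_def.mp (ℳ.indep (g * l)) (hf g m hm) (h1 hf')

/-- The `G`-grading of `END_A(M)` by the degree. -/
def endGrading : RingGrading G ℳ.endRing where
  comp l := (ℳ.degreeEnd l).comap ℳ.endRing.subtype.toAddMonoidHom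
  one_mem := fun g m hm => by rw [mul_one]; exact hm
  mul_mem := by
    intro k l x y hx hy g m hm
    rw [← mul_assoc]
    exact hy _ _ (hx g m hm)
  indep := by
    intro l
    rw [AddSubgroup.disjoint_def]
    intro x hx hx'
    have h2 : (⨆ k, ⨆ (_ : k ≠ l),
        (ℳ.degreeEnd k).comap ℳ.endRing.subtype.toAddMonoidHom) ≤
        (⨆ k, ⨆ (_ : k ≠ l), ℳ.degreeEnd k).comap ℳ.endRing.subtype.toAddMonoidHom := by
      refine iSup₂_le fun k hk => AddSubgroup.comap_mono ?_
      exact le_iSup₂_of_le k hk le_rfl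
    exact Subtype.ext (AddSubgroup.disjoint_def.mp (ℳ.degreeEnd_indep l) hx (h2 hx'))
  iSup_eq_top := by
    rw [eq_top_iff]
    rintro ⟨x, hx⟩ -
    have key : ∀ y, y ∈ (⨆ l, ℳ.degreeEnd l : AddSubgroup (Module.End A M)ᵐᵒᵖ) →
        ∀ hy : y ∈ ℳ.endRing, (⟨y, hy⟩ : ℳ.endRing) ∈
          ⨆ l, (ℳ.degreeEnd l).comap ℳ.endRing.subtype.toAddMonoidHom := by
      intro y hy'
      induction hy' using AddSubgroup.iSup_induction' with
      | h1 => intro hy; exact zero_mem _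
      | hadd y z hy hz ihy ihz => intro _; exact add_mem (ihy hy) (ihz hz)
      | hp l y hy => intro hy'; exact AddSubgroup.mem_iSup_of_mem l hy
    exact key x hx hx

end ModuleGrading

/-- The graded rings `A` and `B` are graded equivalent: there is a graded left `A`-module `P` which
is a progenerator and such that `END_A(P) ≃ B` as graded rings. (Being finitely generated, `P` may
be taken in any universe containing that of `A`.) -/
def GradedEquivalent {G : Type w} {A : Type u} {B : Type v} [Group G] [Ring A] [Ring B]
    (𝒜 : RingGrading G A) (ℬ : RingGrading G B) : Prop :=
  ∃ (P : Type (max u v)) (_ : AddCommGroup P) (_ : Module A P) (𝒬 : ModuleGrading 𝒜 P),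
    IsProgenerator A P ∧ GradedRingIso 𝒬.endGrading.comp ℬ.comp

/-! ### Partial crossed products -/

/-- For a central idempotent `c` of `S`, the ideal `S c`, as a ring with identity `c`. -/
def unitalIdeal {S : Type*} [Ring S] (c : S) : NonUnitalSubring S where
  carrier := {x | x * c = x}
  zero_mem' := zero_mul c
  add_mem' := fun {x y} hx hy => by
    change (x + y) * c = x + y
    rw [add_mul, show x * c = x from hx, show y * c = y from hy]
  neg_mem' := fun {x} hx => by
    change -x * c = -x
    rw [neg_mul, show x * c = x from hx]
  mul_mem' := fun {x y} _ hy => by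
    change x * y * c = x * y
    rw [mul_assoc, show y * c = y from hy]

/-- Ideals `D_g = S 1_g` generated by central idempotents `1_g`, and ring isomorphisms
`α_g : D_{g⁻¹} → D_g`. -/
structure PartialIsoFamily (G S : Type*) [Group G] [Ring S] where
  /-- the central idempotents `1_g` -/
  e : G → S
  e_idem : ∀ g, IsIdempotentElem (e g)
  e_central : ∀ g x, e g * x = x * e g
  α : ∀ g, unitalIdeal (e g⁻¹) ≃+* unitalIdeal (e g)

namespace PartialIsoFamily

variable {G S : Type*} [Group G] [Ring S] (θ : PartialIsoFamily G S)

/-- The map `x ↦ α_g(x 1_{g⁻¹})` on `S`; it extends `α_g`. -/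
def act (g : G) (x : S) : S :=
  θ.α g ⟨x * θ.e g⁻¹, by
    change x * θ.e g⁻¹ * θ.e g⁻¹ = _
    rw [mul_assoc, θ.e_idem g⁻¹]⟩

theorem act_mem (g : G) (x : S) : θ.act g x ∈ unitalIdeal (θ.e g) :=
  (θ.α g _).2

end PartialIsoFamily

/-- A unital twisted partial action of `G` on `S`. The ideals `D_g D_h` are generated by
the central idempotents `1_g 1_h`, and `D_g D_h = D_g ∩ D_h`. -/
structure UnitalTwistedPartialAction (G S : Type*) [Group G] [Ring S] extends
    PartialIsoFamily G S where
  /-- the twisting: `ω_{g,h}` is a unit of `D_g D_{gh}` -/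
  ω : G → G → S
  /-- the inverse of `ω_{g,h}` in `D_g D_{gh}` -/
  ωinv : G → G → S
  ω_mem : ∀ g h, ω g h ∈ unitalIdeal (e g * e (g * h))
  ωinv_mem : ∀ g h, ωinv g h ∈ unitalIdeal (e g * e (g * h))
  ω_mul_ωinv : ∀ g h, ω g h * ωinv g h = e g * e (g * h)
  ωinv_mul_ω : ∀ g h, ωinv g h * ω g h = e g * e (g * h)
  /-- `D_1 = S` -/
  e_one : e 1 = 1
  /-- `α_1` is the identity -/
  α_one : ∀ x : S, toPartialIsoFamily.act 1 x = x
  /-- `α_g(D_{g⁻¹} D_h) = D_g D_{gh}` -/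
  α_image : ∀ (g h : G) (x : unitalIdeal (e g⁻¹)),
    (x : S) ∈ unitalIdeal (e h) ↔ (α g x : S) ∈ unitalIdeal (e (g * h))
  /-- `α_g(α_h(t)) = ω_{g,h} α_{gh}(t) ω_{g,h}⁻¹` for `t ∈ D_{h⁻¹} D_{(gh)⁻¹}` -/
  α_α : ∀ (g h : G) (t : S), t ∈ unitalIdeal (e h⁻¹) → t ∈ unitalIdeal (e (g * h)⁻¹) →
    toPartialIsoFamily.act g (toPartialIsoFamily.act h t) =
      ω g h * toPartialIsoFamily.act (g * h) t * ωinv g h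
  /-- `ω_{1,g} = 1_g` -/
  ω_one_left : ∀ g, ω 1 g = e g
  /-- `ω_{g,1} = 1_g` -/
  ω_one_right : ∀ g, ω g 1 = e g
  /-- `α_g(ω_{h,l} 1_{g⁻¹}) ω_{g,hl} = ω_{g,h} ω_{gh,l}` -/
  cocycle : ∀ g h l, toPartialIsoFamily.act g (ω h l) * ω g (h * l) = ω g h * ω (g * h) l

namespace UnitalTwistedPartialAction

variable {G S : Type*} [Group G] [Ring S] (θ : UnitalTwistedPartialAction G S)

/-- The additive group `⨁_g D_g δ_g`: finitely supported functions `f` on `G` with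
`f g ∈ D_g` for all `g`. -/
def crossedProduct : AddSubgroup (G →₀ S) where
  carrier := {f | ∀ g, f g ∈ unitalIdeal (θ.e g)}
  zero_mem' := fun _ => zero_mem _
  add_mem' := fun hx hy g => add_mem (hx g) (hy g)
  neg_mem' := fun hx g => neg_mem (hx g)

theorem product_mem (g h : G) (a b : S) :
    Finsupp.single (g * h) (a * θ.act g b * θ.ω g h) ∈ θ.crossedProduct := by
  classical
  intro k
  rw [Finsupp.single_apply]
  split_ifs with hk
  · subst hk
    change _ * _ = _
    have h1 : θ.ω g h * (θ.e g * θ.e (g * h)) = θ.ω g h := θ.ω_mem g h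
    have h2 : θ.ω g h * θ.e (g * h) = θ.ω g h := by
      conv_lhs => rw [← h1]
      rw [mul_assoc, mul_assoc, (θ.e_idem (g * h)).eq, h1]
    rw [mul_assoc, h2]
  · exact zero_mem _

/-- The product of the partial crossed product `S ⋆ G`, the biadditive extension of
`(a δ_g) (b δ_h) = a α_g(b 1_{g⁻¹}) ω_{g,h} δ_{gh}`. -/
instance : Mul θ.crossedProduct where
  mul x y :=
    ⟨(x : G →₀ S).sum fun g a => (y : G →₀ S).sum fun h b =>
        Finsupp.single (g * h) (a * θ.act g b * θ.ω g h),
      AddSubgroup.sum_mem _ fun g _ => AddSubgroup.sum_mem _ fun h _ =>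
        θ.product_mem g h _ _⟩

/-- The homogeneous component `D_g δ_g` of `S ⋆ G`. -/
def crossedComp (g : G) : AddSubgroup θ.crossedProduct where
  carrier := {x | ∀ h, h ≠ g → (x : G →₀ S) h = 0}
  zero_mem' := fun _ _ => rfl
  add_mem' := fun {x y} hx hy h hh => by
    change (x : G →₀ S) h + (y : G →₀ S) h = 0
    rw [hx h hh, hy h hh, add_zero]
  neg_mem' := fun {x} hx h hh => by
    change -(x : G →₀ S) h = 0
    rw [hx h hh, neg_zero]

end UnitalTwistedPartialAction

/-- The `G`-graded ring `B` is a partial crossed product: it is isomorphic, as a graded ring, to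
`S ⋆ G` for a unital twisted partial action of `G` on a ring `S`. -/
def IsPartialCrossedProduct {G : Type w} {B : Type u} [Group G] [Ring B]
    (ℬ : RingGrading G B) : Prop :=
  ∃ (S : Type u) (_ : Ring S) (θ : UnitalTwistedPartialAction G S),
    GradedRingIso ℬ.comp θ.crossedComp

end

/-!
# Graded endomorphism rings of induced modules as partial crossed products

The argument rests on one criterion. If every nonzero component `B_g` of a graded ring `B` contains
a unit with homogeneous inverse, then `B` is a partial crossed product
(`RingGrading.isPartialCrossedProduct_of_units`): choose such `u_g` with inverses `v_g`, let `G` act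
on `B_1` by `x ↦ u_g x v_g`, with the twist `u_g u_h v_{gh}`, and send `a δ_g` to `a u_g`. The
construction is carried out for elements that are invertible only up to local identities
(`RingGrading.PartialUnits`). For `B = END_A(M)` the criterion asks for an automorphism of degree `g`
of `M` whenever there is a nonzero endomorphism of degree `g`; it is applied to induced modules in two
ways.

* If `P` is `G`-invariant and `A_g ≠ 0`, an isomorphism `P ≃ A_g ⊗ P` extends to an endomorphism of
  degree `g` of `A ⊗ P`. It is injective because a homogeneous element of degree `h` is detected by
  its products with `A_{h⁻¹}`, and surjective because the identity of `A_{g⁻¹} A_g` acts as the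
  identity on `P ≃ A_{g⁻¹} ⊗ P`.
* An isomorphism `A_g ⊗ R eᵢ ≃ R eⱼ` amounts to elements `x ∈ eⱼ A_g eᵢ` and `y ∈ eᵢ A_{g⁻¹} eⱼ` with
  `x y = eⱼ` and `y x = eᵢ` (`RingGrading.HomogeneousEquiv`). These relations can be composed and
  inverted, and by irredundancy each element of `G_X` acts injectively on the finite set `X`. So `G_X`
  is a group of permutations of `X`, and the elements `x`, `y` assemble to mutually inverse
  endomorphisms of the module induced from `Q_X`.

Graded equivalence holds because `A ⊗_R -` preserves progenerators and, over a semiperfect ring,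
`Q_E` is a progenerator (`IsBasicSet.isProgenerator`): as `R / J(R)` is Artinian, `1` is a sum of
primitive idempotents.

For a partially invertible bimodule `P`, the module `P ⊗ R eᵢ` is a direct summand of `P`. Its
endomorphisms are right multiplications by elements of the local ring `eᵢ R eᵢ`, so it is zero or
indecomposable (`IsPartiallyInvertible.subsingleton_or_equiv`). The components `A_g` are partially
invertible. Hence `ε_g eᵢ ≠ 0` for all `i` puts `g⁻¹`, and therefore `g`, into `G_E`.
-/

namespace RingGrading

/-! ### Graded rings with partially invertible homogeneous elements -/

/-- A choice, for every `g`, of homogeneous elements `u_g ∈ B_g` and `v_g ∈ B_{g⁻¹}` that are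
inverse to each other up to local identities: `u_g v_g` is a left identity of `B_g`, and
`v_g u_g = u_{g⁻¹} v_{g⁻¹}` is a right identity of `B_g`. -/
structure PartialUnits {G B : Type*} [Group G] [Ring B] (ℬ : RingGrading G B) where
  u : G → B
  v : G → B
  u_mem : ∀ g, u g ∈ ℬ.comp g
  v_mem : ∀ g, v g ∈ ℬ.comp g⁻¹
  v_mul_u : ∀ g, v g * u g = u g⁻¹ * v g⁻¹
  left_unital : ∀ g, ∀ b ∈ ℬ.comp g, u g * v g * b = b
  right_unital : ∀ g, ∀ b ∈ ℬ.comp g, b * (v g * u g) = b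
  u_one : u 1 = 1
  v_one : v 1 = 1

namespace PartialUnits

variable {G B : Type*} [Group G] [Ring B] {ℬ : RingGrading G B} (p : PartialUnits ℬ)

/-- The local identity `u_g v_g` of `B_g`. -/
def unitElt (g : G) : B := p.u g * p.v g

theorem v_mul_u' (g : G) : p.v g * p.u g = p.unitElt g⁻¹ := p.v_mul_u g

theorem unitElt_mem (g : G) : p.unitElt g ∈ ℬ.comp 1 := by
  have := ℬ.mul_mem (p.u_mem g) (p.v_mem g)
  rwa [mul_inv_cancel] at this

theorem unitElt_mul {g : G} {b : B} (hb : b ∈ ℬ.comp g) : p.unitElt g * b = b :=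
  p.left_unital g b hb

theorem mul_unitElt {g h : G} (hgh : h = g⁻¹) {b : B} (hb : b ∈ ℬ.comp g) :
    b * p.unitElt h = b := by
  subst hgh
  rw [← v_mul_u', p.right_unital g b hb]

/-- Moving a local identity past a homogeneous element. -/
theorem mul_unitElt_comm {g h k : G} (hk : k = g * h) {a : B} (ha : a ∈ ℬ.comp g) :
    a * p.unitElt h = p.unitElt k * a := by
  subst hk
  have h1 : p.unitElt (g * h) * (a * p.unitElt h) = a * p.unitElt h := by
    rw [unitElt.eq_1 p h, ← mul_assoc a, ← mul_assoc (p.unitElt _),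
      p.unitElt_mul (ℬ.mul_mem ha (p.u_mem h))]
  have h2 : p.v (g * h) * a * p.unitElt h = p.v (g * h) * a :=
    p.mul_unitElt (by group) (ℬ.mul_mem (p.v_mem _) ha)
  rw [← h1, unitElt.eq_1 p (g * h), ← mul_assoc, mul_assoc (p.u _), mul_assoc (p.u _), h2,
    ← mul_assoc]

theorem unitElt_comm (g : G) {x : B} (hx : x ∈ ℬ.comp 1) :
    p.unitElt g * x = x * p.unitElt g :=
  (p.mul_unitElt_comm (one_mul g).symm hx).symm

theorem unitElt_idem (g : G) : p.unitElt g * p.unitElt g = p.unitElt g := by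
  rw [unitElt.eq_1 p g, ← mul_assoc, ← unitElt.eq_1 p g, p.unitElt_mul (p.u_mem g), unitElt]

theorem u_mul_mul_v_mem (g : G) {x : B} (hx : x ∈ ℬ.comp 1) :
    p.u g * x * p.v g ∈ ℬ.comp 1 := by
  simpa using ℬ.mul_mem (ℬ.mul_mem (p.u_mem g) hx) (p.v_mem g)

theorem v_mul_mul_u_mem (g : G) {x : B} (hx : x ∈ ℬ.comp 1) :
    p.v g * x * p.u g ∈ ℬ.comp 1 := by
  simpa using ℬ.mul_mem (ℬ.mul_mem (p.v_mem g) hx) (p.u_mem g)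

theorem v_mul_unitElt (g : G) : p.v g * p.unitElt g = p.v g :=
  p.mul_unitElt (inv_inv g).symm (p.v_mem g)

theorem u_mul_unitElt (g : G) : p.u g * p.unitElt g⁻¹ = p.u g :=
  p.mul_unitElt rfl (p.u_mem g)

theorem unitElt_mul_v (g : G) : p.unitElt g⁻¹ * p.v g = p.v g := p.unitElt_mul (p.v_mem g)

theorem unitElt_mul_u (g : G) : p.unitElt g * p.u g = p.u g := p.unitElt_mul (p.u_mem g)

/-- The local identity of `B_g`, as an element of `B_1`. -/
def baseUnit (g : G) : ℬ.base := ⟨p.unitElt g, p.unitElt_mem g⟩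

theorem mem_unitalIdeal_iff {c x : ℬ.base} : x ∈ unitalIdeal c ↔ (x : B) * c = x :=
  Subtype.ext_iff

theorem coe_baseUnit (g : G) : (p.baseUnit g : B) = p.unitElt g := rfl

/-- The isomorphisms `x ↦ u_g x v_g` between the ideals of `B_1` generated by the local
identities. -/
def isoFamily : PartialIsoFamily G ℬ.base where
  e := p.baseUnit
  e_idem g := Subtype.ext (p.unitElt_idem g)
  e_central g x := Subtype.ext (p.unitElt_comm g x.2)
  α g :=
    { toFun := fun x => ⟨⟨p.u g * (x : ℬ.base) * p.v g, p.u_mul_mul_v_mem g x.1.2⟩, by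
        rw [mem_unitalIdeal_iff, coe_baseUnit]
        change p.u g * _ * p.v g * _ = p.u g * _ * p.v g
        rw [mul_assoc, v_mul_unitElt]⟩
      invFun := fun x => ⟨⟨p.v g * (x : ℬ.base) * p.u g, p.v_mul_mul_u_mem g x.1.2⟩, by
        rw [mem_unitalIdeal_iff, coe_baseUnit]
        change p.v g * _ * p.u g * _ = p.v g * _ * p.u g
        rw [mul_assoc, u_mul_unitElt]⟩
      left_inv := fun x => by
        obtain ⟨x, hx⟩ := x
        rw [mem_unitalIdeal_iff, coe_baseUnit] at hx
        apply Subtype.ext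
        apply Subtype.ext
        change p.v g * (p.u g * (x : B) * p.v g) * p.u g = x
        rw [← mul_assoc, ← mul_assoc, p.v_mul_u', p.unitElt_comm _ x.2, hx, mul_assoc,
          p.v_mul_u', hx]
      right_inv := fun x => by
        obtain ⟨x, hx⟩ := x
        rw [mem_unitalIdeal_iff, coe_baseUnit] at hx
        apply Subtype.ext
        apply Subtype.ext
        change p.u g * (p.v g * (x : B) * p.u g) * p.v g = x
        rw [← mul_assoc, ← mul_assoc, ← unitElt.eq_1, p.unitElt_comm _ x.2, hx, mul_assoc,
          ← unitElt.eq_1, hx]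
      map_mul' := fun x y => by
        obtain ⟨x, hx⟩ := x
        obtain ⟨y, hy⟩ := y
        rw [mem_unitalIdeal_iff, coe_baseUnit] at hx
        apply Subtype.ext
        apply Subtype.ext
        change p.u g * ((x : B) * y) * p.v g = p.u g * x * p.v g * (p.u g * y * p.v g)
        rw [mul_assoc (p.u g) (y : B), ← mul_assoc (p.u g * (x : B) * p.v g),
          mul_assoc (p.u g * (x : B)), p.v_mul_u', mul_assoc (p.u g) (x : B) (p.unitElt _), hx]
        simp only [mul_assoc]
      map_add' := fun x y => by
        apply Subtype.ext
        apply Subtype.ext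
        change p.u g * ((x.1 : B) + y.1) * p.v g =
          p.u g * (x.1 : B) * p.v g + p.u g * (y.1 : B) * p.v g
        rw [mul_add, add_mul] }

theorem coe_act (g : G) (x : ℬ.base) : (p.isoFamily.act g x : B) = p.u g * x * p.v g := by
  change p.u g * ((x : B) * p.unitElt g⁻¹) * p.v g = _
  rw [mul_assoc, mul_assoc, p.unitElt_mul_v, mul_assoc]

theorem twist_mem (g h : G) : p.u g * p.u h * p.v (g * h) ∈ ℬ.comp 1 := by
  simpa only [mul_inv_cancel] using ℬ.mul_mem (ℬ.mul_mem (p.u_mem g) (p.u_mem h)) (p.v_mem (g * h))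

theorem twistInv_mem (g h : G) : p.u (g * h) * (p.v h * p.v g) ∈ ℬ.comp 1 := by
  have := ℬ.mul_mem (p.u_mem (g * h)) (ℬ.mul_mem (p.v_mem h) (p.v_mem g))
  rwa [← mul_inv_rev, mul_inv_cancel] at this

theorem u_mul_u_mul_unitElt (g h : G) :
    p.u g * p.u h * p.unitElt (g * h)⁻¹ = p.u g * p.u h :=
  p.mul_unitElt rfl (ℬ.mul_mem (p.u_mem g) (p.u_mem h))

theorem twist_mul_twistInv (g h : G) :
    p.u g * p.u h * p.v (g * h) * (p.u (g * h) * (p.v h * p.v g)) =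
      p.unitElt g * p.unitElt (g * h) := by
  rw [← mul_assoc, mul_assoc (p.u g * p.u h), v_mul_u', u_mul_u_mul_unitElt, ← mul_assoc,
    mul_assoc (p.u g), ← unitElt.eq_1, p.mul_unitElt_comm rfl (p.u_mem g), mul_assoc,
    ← unitElt.eq_1, p.unitElt_comm _ (p.unitElt_mem g)]

theorem twistInv_mul_twist (g h : G) :
    p.u (g * h) * (p.v h * p.v g) * (p.u g * p.u h * p.v (g * h)) =
      p.unitElt g * p.unitElt (g * h) := by
  have h1 : p.v h * p.unitElt g⁻¹ = p.unitElt (g * h)⁻¹ * p.v h :=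
    p.mul_unitElt_comm (mul_inv_rev g h) (p.v_mem h)
  have h2 : p.u (g * h) * p.unitElt h⁻¹ = p.unitElt g * p.u (g * h) :=
    p.mul_unitElt_comm (by group) (p.u_mem _)
  calc _ = p.u (g * h) * (p.v h * (p.v g * p.u g)) * p.u h * p.v (g * h) := by
        simp only [mul_assoc]
    _ = p.u (g * h) * p.unitElt (g * h)⁻¹ * (p.v h * p.u h) * p.v (g * h) := by
        rw [v_mul_u', h1]; simp only [mul_assoc]
    _ = _ := by rw [u_mul_unitElt, v_mul_u', h2, mul_assoc, ← unitElt.eq_1]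

/-- The unital twisted partial action of `G` on `B_1` with `α_g(x) = u_g x v_g` and
`ω_{g,h} = u_g u_h v_{gh}`. -/
def twistedAction : UnitalTwistedPartialAction G ℬ.base where
  toPartialIsoFamily := p.isoFamily
  ω g h := ⟨p.u g * p.u h * p.v (g * h), p.twist_mem g h⟩
  ωinv g h := ⟨p.u (g * h) * (p.v h * p.v g), p.twistInv_mem g h⟩
  ω_mem g h := by
    rw [mem_unitalIdeal_iff]
    change p.u g * p.u h * p.v (g * h) * (p.unitElt g * p.unitElt (g * h)) = _
    rw [p.unitElt_comm _ (p.unitElt_mem _), ← mul_assoc, mul_assoc _ (p.v _), v_mul_unitElt,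
      ← p.unitElt_comm _ (p.twist_mem g h), ← mul_assoc, ← mul_assoc, unitElt_mul_u]
  ωinv_mem g h := by
    rw [mem_unitalIdeal_iff]
    change p.u (g * h) * (p.v h * p.v g) * (p.unitElt g * p.unitElt (g * h)) = _
    rw [← mul_assoc, mul_assoc (p.u _), mul_assoc (p.v h), v_mul_unitElt,
      ← p.unitElt_comm _ (p.twistInv_mem g h), ← mul_assoc, unitElt_mul_u]
  ω_mul_ωinv g h := Subtype.ext (p.twist_mul_twistInv g h)
  ωinv_mul_ω g h := Subtype.ext (p.twistInv_mul_twist g h)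
  e_one := Subtype.ext (by
    change p.u 1 * p.v 1 = 1
    rw [p.u_one, p.v_one, one_mul])
  α_one x := Subtype.ext (by rw [coe_act, p.u_one, p.v_one, one_mul, mul_one])
  α_image g h x := by
    obtain ⟨x, hx⟩ := x
    rw [mem_unitalIdeal_iff] at hx
    rw [mem_unitalIdeal_iff, mem_unitalIdeal_iff]
    change (x : B) * p.unitElt h = x ↔
      p.u g * x * p.v g * p.unitElt (g * h) = p.u g * x * p.v g
    change (x : B) * p.unitElt g⁻¹ = x at hx
    have h1 : p.u g * x * p.v g * p.unitElt (g * h) = p.u g * (x * p.unitElt h) * p.v g := by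
      rw [mul_assoc, p.mul_unitElt_comm (k := h) (by group) (p.v_mem g)]
      simp only [mul_assoc]
    rw [h1]
    constructor
    · intro h2
      rw [h2]
    · intro h2
      have h3 := congrArg (fun z => p.v g * z * p.u g) h2
      have h4 : ∀ z ∈ ℬ.comp 1, p.v g * (p.u g * z * p.v g) * p.u g =
          z * p.unitElt g⁻¹ := fun z hz => by
        rw [← mul_assoc, ← mul_assoc, v_mul_u', mul_assoc, v_mul_u', p.unitElt_comm _ hz,
          mul_assoc, unitElt_idem]
      beta_reduce at h3
      rw [h4 _ (ℬ.base.mul_mem x.2 (p.unitElt_mem h)), h4 _ x.2, hx, mul_assoc,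
        p.unitElt_comm _ (p.unitElt_mem _), ← mul_assoc, hx] at h3
      exact h3
  α_α g h t _ ht := by
    rw [mem_unitalIdeal_iff] at ht
    change (t : B) * p.unitElt (g * h)⁻¹ = t at ht
    apply Subtype.ext
    change (p.isoFamily.act g (p.isoFamily.act h t) : B) =
      p.u g * p.u h * p.v (g * h) * (p.isoFamily.act (g * h) t : B) *
        (p.u (g * h) * (p.v h * p.v g))
    rw [coe_act, coe_act, coe_act]
    calc _ = p.u g * p.u h * t * (p.v h * p.v g) := by simp only [mul_assoc]
      _ = p.u g * p.u h * p.unitElt (g * h)⁻¹ * (t * p.unitElt (g * h)⁻¹) *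
          (p.v h * p.v g) := by
        rw [ht, u_mul_u_mul_unitElt]
      _ = _ := by rw [← v_mul_u']; simp only [mul_assoc]
  ω_one_left g := Subtype.ext (by
    change p.u 1 * p.u g * p.v (1 * g) = p.u g * p.v g
    rw [p.u_one, one_mul, one_mul])
  ω_one_right g := Subtype.ext (by
    change p.u g * p.u 1 * p.v (g * 1) = p.u g * p.v g
    rw [p.u_one, mul_one, mul_one])
  cocycle g h l := by
    apply Subtype.ext
    change (p.isoFamily.act g _ : B) * (p.u g * p.u (h * l) * p.v (g * (h * l))) =
      p.u g * p.u h * p.v (g * h) * (p.u (g * h) * p.u l * p.v (g * h * l))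
    rw [coe_act]
    have h1 : p.unitElt g⁻¹ * p.u (h * l) = p.u (h * l) * p.unitElt (g * (h * l))⁻¹ :=
      (p.mul_unitElt_comm (by group) (p.u_mem _)).symm
    calc _ = p.u g * (p.u h * p.u l * p.v (h * l)) * (p.v g * p.u g) * p.u (h * l) *
          p.v (g * (h * l)) := by simp only [mul_assoc]
      _ = p.u g * (p.u h * p.u l * (p.v (h * l) * p.u (h * l))) * (p.unitElt (g * (h * l))⁻¹ *
          p.v (g * (h * l))) := by
        rw [v_mul_u', mul_assoc _ (p.unitElt _), h1]; simp only [mul_assoc]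
      _ = p.u g * (p.u h * p.u l) * p.v (g * (h * l)) := by
        rw [unitElt_mul_v, v_mul_u', u_mul_u_mul_unitElt]
      _ = p.u g * p.u h * p.u l * p.v (g * h * l) := by simp only [mul_assoc]
      _ = p.u g * p.u h * (p.v (g * h) * p.u (g * h)) * p.u l * p.v (g * h * l) := by
        rw [v_mul_u', u_mul_u_mul_unitElt]
      _ = _ := by simp only [mul_assoc]

/-- The map `∑ a_g δ_g ↦ ∑ a_g u_g` from the partial crossed product to `B`. -/
noncomputable def fromCrossed : p.twistedAction.crossedProduct →+ B :=
  (Finsupp.liftAddHom fun g =>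
    (AddMonoidHom.mulRight (p.u g)).comp ℬ.base.subtype.toAddMonoidHom).comp
      p.twistedAction.crossedProduct.subtype

theorem fromCrossed_apply (x : p.twistedAction.crossedProduct) :
    p.fromCrossed x = (x : G →₀ ℬ.base).sum fun g a => (a : B) * p.u g := rfl

theorem mul_u_mem (g : G) (a : ℬ.base) : (a : B) * p.u g ∈ ℬ.comp g := by
  have := ℬ.mul_mem (g := 1) (h := g) a.2 (p.u_mem g)
  rwa [one_mul] at this

theorem fromCrossed_mul (x y : p.twistedAction.crossedProduct) :
    p.fromCrossed (x * y) = p.fromCrossed x * p.fromCrossed y := by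
  have key : ∀ (g h : G) (a b : ℬ.base),
      ((a * p.isoFamily.act g b * p.twistedAction.ω g h : ℬ.base) : B) * p.u (g * h) =
        (a : B) * p.u g * (b * p.u h) := by
    intro g h a b
    change (a : B) * (p.isoFamily.act g b : B) * (p.u g * p.u h * p.v (g * h)) *
      p.u (g * h) = _
    rw [coe_act, mul_assoc _ (p.u g * p.u h * _), mul_assoc (p.u g * p.u h), v_mul_u',
      u_mul_u_mul_unitElt]
    have h1 : p.u g * b * p.unitElt g⁻¹ = p.u g * b := by
      refine p.mul_unitElt rfl ?_
      simpa using ℬ.mul_mem (h := 1) (p.u_mem g) b.2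
    calc _ = a * (p.u g * b * (p.v g * p.u g)) * p.u h := by simp only [mul_assoc]
      _ = _ := by rw [v_mul_u', h1]; simp only [mul_assoc]
  let L : (G →₀ ℬ.base) →+ B := Finsupp.liftAddHom fun g =>
    (AddMonoidHom.mulRight (p.u g)).comp ℬ.base.subtype.toAddMonoidHom
  have hL : ∀ g (a : ℬ.base), L (Finsupp.single g a) = a * p.u g := fun g a =>
    Finsupp.liftAddHom_apply_single _ _ _
  change L ((x : G →₀ ℬ.base).sum fun g a => (y : G →₀ ℬ.base).sum fun h b =>
    Finsupp.single (g * h) (a * p.isoFamily.act g b * p.twistedAction.ω g h)) = _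
  rw [fromCrossed_apply, fromCrossed_apply, Finsupp.sum, Finsupp.sum, Finsupp.sum,
    Finset.sum_mul_sum, map_sum]
  refine Finset.sum_congr rfl fun g _ => ?_
  rw [Finsupp.sum, map_sum]
  refine Finset.sum_congr rfl fun h _ => ?_
  rw [hL, key]

/-- The element `(b v_g) δ_g` of the partial crossed product that is mapped to `b ∈ B_g`. -/
noncomputable def toCrossed (g : G) (b : B) (hb : b ∈ ℬ.comp g) : p.twistedAction.crossedProduct :=
  ⟨Finsupp.single g ⟨b * p.v g, by
    have := ℬ.mul_mem hb (p.v_mem g)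
    rwa [mul_inv_cancel] at this⟩, by
    classical
    intro h
    rw [Finsupp.single_apply]
    split_ifs with hgh
    · subst hgh
      rw [mem_unitalIdeal_iff]
      change b * p.v g * p.unitElt g = b * p.v g
      rw [mul_assoc, v_mul_unitElt]
    · exact zero_mem _⟩

theorem fromCrossed_toCrossed (g : G) (b : B) (hb : b ∈ ℬ.comp g) :
    p.fromCrossed (p.toCrossed g b hb) = b := by
  rw [fromCrossed_apply, toCrossed, Finsupp.sum_single_index]
  · rw [mul_assoc, v_mul_u', p.mul_unitElt rfl hb]
  · exact zero_mul _

theorem fromCrossed_injective : Function.Injective p.fromCrossed := by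
  rw [injective_iff_map_eq_zero]
  intro x hx
  apply Subtype.ext
  ext g
  obtain ⟨π, h1, h2⟩ := exists_projection ℬ.comp ℬ.indep ℬ.iSup_eq_top g
  have h3 : π (p.fromCrossed x) = ((x : G →₀ ℬ.base) g : B) * p.u g := by
    classical
    rw [fromCrossed_apply, Finsupp.sum, map_sum, Finset.sum_eq_single g]
    · exact h1 _ (p.mul_u_mem _ _)
    · intro h _ hh
      exact h2 h hh _ (p.mul_u_mem _ _)
    · intro hg
      rw [Finsupp.notMem_support_iff.mp hg, ZeroMemClass.coe_zero, zero_mul, map_zero]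
  rw [hx, map_zero] at h3
  have h4 := mem_unitalIdeal_iff.mp (x.2 g)
  change _ * (p.u g * p.v g) = _ at h4
  rw [← h4, ← mul_assoc, ← h3, zero_mul]
  rfl

theorem fromCrossed_surjective : Function.Surjective p.fromCrossed := by
  rw [← AddMonoidHom.range_eq_top, eq_top_iff, ← ℬ.iSup_eq_top]
  exact iSup_le fun g b hb => ⟨_, p.fromCrossed_toCrossed g b hb⟩

theorem fromCrossed_mem_iff (g : G) (x : p.twistedAction.crossedProduct) :
    p.fromCrossed x ∈ ℬ.comp g ↔ x ∈ p.twistedAction.crossedComp g := by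
  classical
  constructor
  · intro hx h hh
    have h1 := p.fromCrossed_injective (p.fromCrossed_toCrossed g _ hx)
    rw [← h1]
    exact Finsupp.single_eq_of_ne hh
  · intro hx
    rw [fromCrossed_apply]
    refine sum_mem fun h _ => ?_
    by_cases hh : h = g
    · subst hh
      exact p.mul_u_mem _ _
    · change ((x : G →₀ ℬ.base) h : B) * p.u h ∈ _
      rw [hx h hh, ZeroMemClass.coe_zero, zero_mul]
      exact zero_mem _

end PartialUnits

/-- A graded ring with a system of partially invertible homogeneous elements is the partial
crossed product of the associated twisted partial action on its component of degree `1`. -/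
theorem PartialUnits.isPartialCrossedProduct {G : Type w} {B : Type u} [Group G] [Ring B]
    {ℬ : RingGrading G B} (p : PartialUnits ℬ) : IsPartialCrossedProduct ℬ := by
  let ψ : p.twistedAction.crossedProduct ≃+* B :=
    { Equiv.ofBijective p.fromCrossed ⟨p.fromCrossed_injective, p.fromCrossed_surjective⟩ with
      map_mul' := p.fromCrossed_mul
      map_add' := p.fromCrossed.map_add }
  refine ⟨ℬ.base, inferInstance, p.twistedAction, ψ.symm, fun g b => ?_⟩
  rw [← p.fromCrossed_mem_iff]
  change _ ↔ ψ (ψ.symm b) ∈ _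
  rw [ψ.apply_symm_apply]

/-- If every nonzero component of a graded ring contains a unit whose inverse is homogeneous, then
the ring is a partial crossed product (all of whose local identities are `0` or `1`). -/
theorem isPartialCrossedProduct_of_units {G : Type w} {B : Type u} [Group G] [Ring B]
    (ℬ : RingGrading G B)
    (h : ∀ g, ℬ.comp g = ⊥ ∨ ∃ x ∈ ℬ.comp g, ∃ y ∈ ℬ.comp g⁻¹, x * y = 1 ∧ y * x = 1) :
    IsPartialCrossedProduct ℬ := by
  classical
  have key : ∀ g, ∃ x ∈ ℬ.comp g, ∃ y ∈ ℬ.comp g⁻¹, (g = 1 → x = 1 ∧ y = 1) ∧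
      ((x * y = 1 ∧ y * x = 1) ∨ (x = 0 ∧ y = 0 ∧ ℬ.comp g = ⊥ ∧ ℬ.comp g⁻¹ = ⊥)) := by
    intro g
    by_cases hg : g = 1
    · subst hg
      exact ⟨1, ℬ.one_mem, 1, by rw [inv_one]; exact ℬ.one_mem, by simp, by simp⟩
    · rcases h g with h0 | ⟨x, hx, y, hy, h1, h2⟩
      · rcases h g⁻¹ with h0' | ⟨y, hy, x, hx, h1, h2⟩
        · exact ⟨0, zero_mem _, 0, zero_mem _, fun h => absurd h hg, Or.inr ⟨rfl, rfl, h0, h0'⟩⟩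
        · rw [inv_inv] at hx
          exact ⟨x, hx, y, hy, fun h => absurd h hg, Or.inl ⟨h2, h1⟩⟩
      · exact ⟨x, hx, y, hy, fun h => absurd h hg, Or.inl ⟨h1, h2⟩⟩
  choose x hx y hy h1 hxy using key
  -- In the zero ring both alternatives may hold, so the two cases are compared by hand.
  have hz : ∀ g, x g = 0 ∧ y g = 0 ∧ ℬ.comp g = ⊥ ∧ ℬ.comp g⁻¹ = ⊥ → x g⁻¹ * y g⁻¹ = 0 := by
    rintro g ⟨-, -, -, h0⟩
    have := hx g⁻¹
    rw [h0, AddSubgroup.mem_bot] at this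
    rw [this, zero_mul]
  have hz' : ∀ g, x g⁻¹ = 0 ∧ y g⁻¹ = 0 ∧ ℬ.comp g⁻¹ = ⊥ ∧ ℬ.comp g⁻¹⁻¹ = ⊥ → y g * x g = 0 := by
    rintro g ⟨-, -, h0, -⟩
    have := hy g
    rw [h0, AddSubgroup.mem_bot] at this
    rw [this, zero_mul]
  refine PartialUnits.isPartialCrossedProduct (ℬ := ℬ) ⟨x, y, hx, hy, fun g => ?_,
    fun g b hb => ?_, fun g b hb => ?_, (h1 1 rfl).1, (h1 1 rfl).2⟩
  · rcases hxy g with hg | hg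
    · rcases hxy g⁻¹ with hg' | hg'
      · rw [hg.2, hg'.1]
      · rw [hz' g hg', hg'.1, zero_mul]
    · rw [hz g hg, hg.1, mul_zero]
  · rcases hxy g with hg | hg
    · rw [hg.1, one_mul]
    · rw [hg.2.2.1, AddSubgroup.mem_bot] at hb
      rw [hb, mul_zero]
  · rcases hxy g with hg | hg
    · rw [hg.2, mul_one]
    · rw [hg.2.2.1, AddSubgroup.mem_bot] at hb
      rw [hb, zero_mul]

end RingGrading

/-! ### Maps out of tensor products over a noncommutative ring -/

section BimoduleTensor

variable {S R P M : Type*} [Ring S] [Ring R] [AddCommGroup P] [AddCommGroup M]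
  [Module S P] [Module Rᵐᵒᵖ P] [SMulCommClass S Rᵐᵒᵖ P] [Module R M]

theorem bimoduleTmul_add (p : P) (m m' : M) :
    bimoduleTmul S R p (m + m') = bimoduleTmul S R p m + bimoduleTmul S R p m' := by
  rw [bimoduleTmul, TensorProduct.tmul_add, map_add]; rfl

theorem add_bimoduleTmul (p p' : P) (m : M) :
    bimoduleTmul S R (p + p') m = bimoduleTmul S R p m + bimoduleTmul S R p' m := by
  rw [bimoduleTmul, TensorProduct.add_tmul, map_add]; rfl

theorem zero_bimoduleTmul (m : M) : bimoduleTmul S R (0 : P) m = 0 := by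
  rw [bimoduleTmul, TensorProduct.zero_tmul, map_zero]

theorem smul_bimoduleTmul (s : S) (p : P) (m : M) :
    s • bimoduleTmul S R p m = bimoduleTmul S R (s • p) m := rfl

theorem op_smul_bimoduleTmul (p : P) (r : R) (m : M) :
    bimoduleTmul S R (MulOpposite.op r • p) m = bimoduleTmul S R p (r • m) := by
  rw [bimoduleTmul, bimoduleTmul, ← sub_eq_zero, ← map_sub, Submodule.mkQ_apply,
    Submodule.Quotient.mk_eq_zero]
  exact AddSubgroup.subset_closure ⟨p, r, m, rfl⟩

variable (S R P) in
/-- The map `p ↦ p ⊗ m`. -/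
def tmulLeft (m : M) : P →ₗ[S] BimoduleTensor S R P M where
  toFun p := bimoduleTmul S R p m
  map_add' p p' := add_bimoduleTmul p p' m
  map_smul' _ _ := rfl

variable (S R P M) in
/-- The map `m ↦ p ⊗ m`. -/
def tmulRight (p : P) : M →+ BimoduleTensor S R P M where
  toFun m := bimoduleTmul S R p m
  map_zero' := by rw [bimoduleTmul, TensorProduct.tmul_zero, map_zero]
  map_add' m m' := bimoduleTmul_add p m m'

theorem bimoduleTensor_induction {C : BimoduleTensor S R P M → Prop}
    (x : BimoduleTensor S R P M) (zero : C 0) (add : ∀ x y, C x → C y → C (x + y))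
    (tmul : ∀ p m, C (bimoduleTmul S R p m)) : C x := by
  obtain ⟨y, rfl⟩ := (balancingSubmodule S R P M).mkQ_surjective x
  induction y using TensorProduct.induction_on with
  | zero => rw [map_zero]; exact zero
  | add x y hx hy => rw [map_add]; exact add _ _ hx hy
  | tmul p m => exact tmul p m

variable (S) in
/-- A balanced biadditive map induces an additive map on `P ⊗_R M`. -/
theorem exists_bimoduleLift {N : Type*} [AddCommGroup N] (f : P →+ M →+ N)
    (hf : ∀ p (r : R) m, f (MulOpposite.op r • p) m = f p (r • m)) :
    ∃ F : BimoduleTensor S R P M →+ N, ∀ p m, F (bimoduleTmul S R p m) = f p m := by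
  let T : (P ⊗[ℤ] M) →+ N := TensorProduct.liftAddHom f fun n p m => by simp
  have hT : (balancingSubmodule S R P M).toAddSubgroup ≤ T.ker := by
    change AddSubgroup.closure (balancingRelations R P M) ≤ T.ker
    rw [AddSubgroup.closure_le]
    rintro _ ⟨a, r, m, rfl⟩
    change T _ = 0
    rw [map_sub, sub_eq_zero]
    exact hf a r m
  exact ⟨QuotientAddGroup.lift (balancingSubmodule S R P M).toAddSubgroup T hT, fun _ _ => rfl⟩

theorem exists_bimoduleLift_linear {N : Type*} [AddCommGroup N] [Module S N] (f : P →ₗ[S] M →+ N)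
    (hf : ∀ p (r : R) m, f (MulOpposite.op r • p) m = f p (r • m)) :
    ∃ F : BimoduleTensor S R P M →ₗ[S] N, ∀ p m, F (bimoduleTmul S R p m) = f p m := by
  obtain ⟨F, hF⟩ := exists_bimoduleLift S f.toAddMonoidHom hf
  refine ⟨{ F with map_smul' := fun s x => ?_ }, hF⟩
  change F (s • x) = s • F x
  induction x using bimoduleTensor_induction with
  | zero => simp
  | add x y hx hy => rw [smul_add, map_add, map_add, smul_add, hx, hy]
  | tmul p m => rw [smul_bimoduleTmul, hF, hF]; simp

end BimoduleTensor

/-! ### Decompositions indexed by a group -/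

section Projections

variable {ι N : Type*} [AddCommGroup N] {C : ι → AddSubgroup N}

theorem exists_finsupp_of_mem_iSup {x : N} (hx : x ∈ ⨆ i, C i) :
    ∃ f : ι →₀ N, (∀ i, f i ∈ C i) ∧ (f.sum fun _ y => y) = x := by
  classical
  induction hx using AddSubgroup.iSup_induction' with
  | h1 => exact ⟨0, fun i => zero_mem _, rfl⟩
  | hp i x hx =>
    refine ⟨Finsupp.single i x, fun j => ?_, Finsupp.sum_single_index rfl⟩
    rw [Finsupp.single_apply]
    split_ifs with h
    · exact h ▸ hx
    · exact zero_mem _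
  | hadd x y _ _ hx hy =>
    obtain ⟨f, hf, rfl⟩ := hx
    obtain ⟨g, hg, rfl⟩ := hy
    exact ⟨f + g, fun i => add_mem (hf i) (hg i),
      Finsupp.sum_add_index' (fun _ => rfl) fun _ _ _ => rfl⟩

theorem eq_zero_of_projections (hi : iSupIndep C) (ht : ⨆ i, C i = ⊤) {x : N}
    (hx : ∀ (i : ι) (π : N →+ N), (∀ y ∈ C i, π y = y) → (∀ j, j ≠ i → ∀ y ∈ C j, π y = 0) →
      π x = 0) : x = 0 := by
  classical
  obtain ⟨f, hf, hfx⟩ := exists_finsupp_of_mem_iSup (C := C) (x := x) (ht ▸ AddSubgroup.mem_top x)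
  have h0 : ∀ i, f i = 0 := by
    intro i
    obtain ⟨π, h1, h2⟩ := exists_projection C hi ht i
    have h3 := hx i π h1 h2
    rw [← hfx, Finsupp.sum, map_sum, Finset.sum_eq_single i] at h3
    · rwa [h1 _ (hf i)] at h3
    · exact fun j _ hj => h2 j hj _ (hf j)
    · intro h
      rw [Finsupp.notMem_support_iff.mp h, map_zero]
  rw [← hfx, Finsupp.sum, Finset.sum_eq_zero fun i _ => h0 i]

end Projections

namespace ModuleGrading

variable {G A M : Type*} [Group G] [Ring A] {𝒜 : RingGrading G A} [AddCommGroup M] [Module A M]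
  (ℳ : ModuleGrading 𝒜 M)

/-- An endomorphism of degree `g` intertwines the projections to the components of degrees `h`
and `hg`. -/
theorem map_projection {g h : G} {f : M →ₗ[A] M}
    (hf : ∀ k, ∀ m ∈ ℳ.comp k, f m ∈ ℳ.comp (k * g)) {π ρ : M →+ M}
    (hπ : ∀ y ∈ ℳ.comp h, π y = y) (hπ' : ∀ j, j ≠ h → ∀ y ∈ ℳ.comp j, π y = 0)
    (hρ : ∀ y ∈ ℳ.comp (h * g), ρ y = y) (hρ' : ∀ j, j ≠ h * g → ∀ y ∈ ℳ.comp j, ρ y = 0)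
    (x : M) : f (π x) = ρ (f x) := by
  have hx : x ∈ ⨆ k, ℳ.comp k := by rw [ℳ.iSup_eq_top]; trivial
  induction hx using AddSubgroup.iSup_induction' with
  | h1 => simp
  | hadd x y _ _ hx hy => simp only [map_add, hx, hy]
  | hp k x hx =>
    by_cases hk : k = h
    · subst hk
      rw [hπ x hx, hρ _ (hf k x hx)]
    · rw [hπ' k hk x hx, hρ' (k * g) (fun h' => hk (mul_right_cancel h')) _ (hf k x hx), map_zero]

theorem injective_of_homogeneous {g : G} {f : M →ₗ[A] M}
    (hf : ∀ k, ∀ m ∈ ℳ.comp k, f m ∈ ℳ.comp (k * g))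
    (h0 : ∀ k, ∀ m ∈ ℳ.comp k, f m = 0 → m = 0) : Function.Injective f := by
  rw [injective_iff_map_eq_zero]
  intro x hx
  refine eq_zero_of_projections ℳ.indep ℳ.iSup_eq_top fun h π hπ hπ' => ?_
  have hmem : ∀ x, π x ∈ ℳ.comp h := by
    intro x
    have hx : x ∈ ⨆ k, ℳ.comp k := by rw [ℳ.iSup_eq_top]; trivial
    induction hx using AddSubgroup.iSup_induction' with
    | h1 => rw [map_zero]; exact zero_mem _
    | hadd x y _ _ hx hy => rw [map_add]; exact add_mem hx hy
    | hp k x hx =>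
      by_cases hk : k = h
      · subst hk
        rwa [hπ x hx]
      · rw [hπ' k hk x hx]; exact zero_mem _
  obtain ⟨ρ, hρ, hρ'⟩ := exists_projection ℳ.comp ℳ.indep ℳ.iSup_eq_top (h * g)
  refine h0 h _ (hmem x) ?_
  rw [ℳ.map_projection hf hπ hπ' hρ hρ', hx, map_zero]

/-- The inverse of a bijective endomorphism of degree `g` has degree `g⁻¹`. -/
theorem symm_mem_comp {g : G} (f : M ≃ₗ[A] M)
    (hf : ∀ k, ∀ m ∈ ℳ.comp k, f m ∈ ℳ.comp (k * g)) (k : G) (m : M) (hm : m ∈ ℳ.comp k) :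
    f.symm m ∈ ℳ.comp (k * g⁻¹) := by
  obtain ⟨ρ, hρ, hρ'⟩ := exists_projection ℳ.comp ℳ.indep ℳ.iSup_eq_top (k * g⁻¹ * g)
  have hρm : ρ m = m := hρ m (by rwa [inv_mul_cancel_right])
  obtain ⟨x, hx⟩ := f.surjective m
  have hx' : x ∈ ⨆ k, ℳ.comp k := by rw [ℳ.iSup_eq_top]; trivial
  -- The part of `f x` of degree `k` is the image of the part of `x` of degree `k * g⁻¹`.
  have key : ∀ x, x ∈ (⨆ k, ℳ.comp k) → ∃ y ∈ ℳ.comp (k * g⁻¹), f y = ρ (f x) := by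
    intro x hx
    induction hx using AddSubgroup.iSup_induction' with
    | h1 => exact ⟨0, zero_mem _, by simp⟩
    | hadd x y _ _ hx hy =>
      obtain ⟨x', hx', hx⟩ := hx
      obtain ⟨y', hy', hy⟩ := hy
      exact ⟨x' + y', add_mem hx' hy', by simp only [map_add, hx, hy]⟩
    | hp l x hx =>
      by_cases hl : l = k * g⁻¹
      · subst hl
        exact ⟨x, hx, (hρ _ (hf _ x hx)).symm⟩
      · refine ⟨0, zero_mem _, ?_⟩
        rw [map_zero, hρ' (l * g) (fun h' => hl (mul_right_cancel h')) _ (hf l x hx)]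
  obtain ⟨y, hy, hfy⟩ := key x hx'
  rw [hx, hρm] at hfy
  rwa [← hfy, f.symm_apply_apply]

/-- If, for every `g`, either there are no nonzero endomorphisms of degree `g` or there is an
automorphism of degree `g`, then `END_A(M)` is a partial crossed product. -/
theorem isPartialCrossedProduct_endGrading
    (h : ∀ g, (∀ f : M →ₗ[A] M, (∀ k, ∀ m ∈ ℳ.comp k, f m ∈ ℳ.comp (k * g)) → f = 0) ∨
      ∃ f : M ≃ₗ[A] M, ∀ k, ∀ m ∈ ℳ.comp k, f m ∈ ℳ.comp (k * g)) :
    IsPartialCrossedProduct ℳ.endGrading := by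
  refine RingGrading.isPartialCrossedProduct_of_units _ fun g => ?_
  rcases h g with h0 | ⟨f, hf⟩
  · left
    rw [eq_bot_iff]
    rintro ⟨x, hx⟩ hx'
    exact Subtype.ext (MulOpposite.unop_injective (h0 _ hx'))
  · right
    have h1 : MulOpposite.op (f : M →ₗ[A] M) ∈ ℳ.degreeEnd g := hf
    have h2 : MulOpposite.op (f.symm : M →ₗ[A] M) ∈ ℳ.degreeEnd g⁻¹ := ℳ.symm_mem_comp f hf
    refine ⟨⟨_, AddSubgroup.mem_iSup_of_mem g h1⟩, h1, ⟨_, AddSubgroup.mem_iSup_of_mem g⁻¹ h2⟩, h2,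
      Subtype.ext (MulOpposite.unop_injective ?_), Subtype.ext (MulOpposite.unop_injective ?_)⟩
    · exact LinearMap.ext fun m => f.symm_apply_apply m
    · exact LinearMap.ext fun m => f.apply_symm_apply m

end ModuleGrading

/-! ### Homomorphisms out of an induced module -/

section Induced

variable {A R M : Type*} [Ring A] [Ring R] [Module Rᵐᵒᵖ A]

variable (A) in
/-- The element of `A` by which `r : R` acts on `A` from the right. -/
def rightElt (r : R) : A := MulOpposite.op r • (1 : A)

theorem rightElt_add (r s : R) : rightElt A (r + s) = rightElt A r + rightElt A s := by
  rw [rightElt, MulOpposite.op_add, add_smul]; rfl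

theorem rightElt_one : rightElt A (1 : R) = 1 := by
  rw [rightElt, MulOpposite.op_one, one_smul]

variable [SMulCommClass A Rᵐᵒᵖ A] [AddCommGroup M] [Module R M]

theorem op_smul_eq_mul_rightElt (r : R) (a : A) : MulOpposite.op r • a = a * rightElt A r := by
  rw [rightElt, ← smul_eq_mul a, smul_comm a, smul_eq_mul, mul_one]

theorem rightElt_smul_tmul (r : R) (m : M) :
    rightElt A r • bimoduleTmul A R (1 : A) m = bimoduleTmul A R 1 (r • m) := by
  rw [smul_bimoduleTmul, ← op_smul_bimoduleTmul, rightElt, smul_eq_mul, mul_one]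

theorem tmul_eq_smul (a : A) (m : M) :
    bimoduleTmul A R a m = a • bimoduleTmul A R (1 : A) m := by
  rw [smul_bimoduleTmul, smul_eq_mul, mul_one]

theorem rightElt_mul (r s : R) : rightElt A (r * s) = rightElt A r * rightElt A s := by
  rw [← op_smul_eq_mul_rightElt, rightElt, rightElt, MulOpposite.op_mul, mul_smul]

/-- Extension of scalars is left adjoint to restriction: an `R`-linear map `M → N` extends to an
`A`-linear map `A ⊗_R M → N`. -/
theorem exists_inducedHom {N : Type*} [AddCommGroup N] [Module A N] (f : M →+ N)
    (hf : ∀ (r : R) m, f (r • m) = rightElt A r • f m) :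
    ∃ F : BimoduleTensor A R A M →ₗ[A] N, ∀ m, F (bimoduleTmul A R 1 m) = f m := by
  obtain ⟨F, hF⟩ := exists_bimoduleLift_linear (S := A) (R := R) (P := A) (M := M)
    (N := N)
    { toFun := fun a => (DistribSMul.toAddMonoidHom N a).comp f
      map_add' := fun a b => by ext m; exact add_smul a b (f m)
      map_smul' := fun a b => by ext m; exact mul_smul a b (f m) } fun a r m => by
    change (MulOpposite.op r • a) • f m = a • f (r • m)
    rw [hf, op_smul_eq_mul_rightElt, mul_smul]
  refine ⟨F, fun m => (hF 1 m).trans ?_⟩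
  exact one_smul A (f m)

theorem inducedHom_ext {N : Type*} [AddCommGroup N] [Module A N]
    {f g : BimoduleTensor A R A M →ₗ[A] N}
    (h : ∀ m, f (bimoduleTmul A R 1 m) = g (bimoduleTmul A R 1 m)) : f = g := by
  refine LinearMap.ext fun x => ?_
  induction x using bimoduleTensor_induction with
  | zero => rw [map_zero, map_zero]
  | add x y hx hy => rw [map_add, map_add, hx, hy]
  | tmul a m => rw [tmul_eq_smul, map_smul, map_smul, h]

theorem IsProgenerator.induced (hM : IsProgenerator R M) :
    IsProgenerator A (BimoduleTensor A R A M) := by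
  obtain ⟨h1, h2, n, f, hf⟩ := hM
  obtain ⟨k, q, s, -, -, hs⟩ := Module.Finite.exists_comp_eq_id_of_projective R M
  -- `M` is a direct summand of `R ^ k`; hence `A ⊗_R M` is a direct summand of `A ^ k`.
  obtain ⟨F, hF⟩ := exists_inducedHom (A := A) (R := R) (M := M) (N := Fin k → A)
    { toFun := fun m i => rightElt A (s m i)
      map_zero' := by ext i; simp [rightElt]
      map_add' := fun m m' => by ext i; simp [rightElt_add] }
    (fun r m => by ext i; simp [rightElt_mul])
  let Q : (Fin k → A) →ₗ[A] BimoduleTensor A R A M :=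
    Fintype.linearCombination A fun i => bimoduleTmul A R (1 : A) (q (Pi.single i 1))
  have hQF : Q ∘ₗ F = LinearMap.id := by
    refine inducedHom_ext fun m => ?_
    rw [LinearMap.comp_apply, hF, LinearMap.id_apply]
    have h3 : ∑ i, s m i • q (Pi.single i 1) = m := by
      calc _ = q (∑ i, s m i • Pi.single i (1 : R)) := by simp only [map_sum, map_smul]
        _ = q (s m) := congrArg q (pi_eq_sum_univ' (s m)).symm
        _ = m := LinearMap.congr_fun hs m
    change ∑ i, rightElt A (s m i) • bimoduleTmul A R (1 : A) (q (Pi.single i 1)) =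
      tmulRight A R A M 1 m
    conv_rhs => rw [← h3, map_sum]
    exact Finset.sum_congr rfl fun i _ => rightElt_smul_tmul _ _
  have hQ : Function.Surjective Q := LinearMap.surjective_of_comp_eq_id _ _ hQF
  refine ⟨Module.Finite.of_surjective Q hQ, Module.Projective.of_split F Q hQF, n, ?_⟩
  have h4 : ∀ i, ∃ E : BimoduleTensor A R A M →ₗ[A] A,
      ∀ m, E (bimoduleTmul A R 1 m) = rightElt A (f (Pi.single i m)) := fun i =>
    exists_inducedHom (A := A) (R := R) (M := M) (N := A)
      { toFun := fun m => rightElt A (f (Pi.single i m))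
        map_zero' := by simp [rightElt]
        map_add' := fun m m' => by rw [Pi.single_add, map_add, rightElt_add] }
      (fun r m => by
        change rightElt A (f (Pi.single i (r • m))) = rightElt A r * _
        rw [Pi.single_smul, map_smul, smul_eq_mul, rightElt_mul]; rfl)
  choose E hE using h4
  obtain ⟨x, hx⟩ := hf 1
  refine ⟨∑ i, E i ∘ₗ LinearMap.proj i, fun a => ⟨a • fun i => bimoduleTmul A R 1 (x i), ?_⟩⟩
  have h5 : ∑ i, rightElt A (f (Pi.single i (x i))) = rightElt A (f x) := by
    conv_rhs => rw [← Finset.univ_sum_single x, map_sum]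
    let ρ : R →+ A := ⟨⟨rightElt A, by simp [rightElt]⟩, rightElt_add⟩
    exact (map_sum ρ _ _).symm
  rw [map_smul, LinearMap.sum_apply]
  simp only [LinearMap.comp_apply, LinearMap.proj_apply, hE]
  rw [h5, hx, rightElt_one, smul_eq_mul, mul_one]

variable {G : Type*} [Group G] (𝒜 : RingGrading G A) [RightStable 𝒜 R]

theorem tmul_mem_inducedComp {g : G} {a : A} (ha : a ∈ 𝒜.comp g) (m : M) :
    (bimoduleTmul A R a m : BimoduleTensor A R A M) ∈ (inducedGrading 𝒜 R M).comp g :=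
  AddSubgroup.subset_closure ⟨a, ha, m, rfl⟩

theorem map_mem_inducedComp {g : G} {f : BimoduleTensor A R A M →ₗ[A] BimoduleTensor A R A M}
    (hf : ∀ m, f (bimoduleTmul A R 1 m) ∈ (inducedGrading 𝒜 R M).comp g) (k : G)
    (x : BimoduleTensor A R A M) (hx : x ∈ (inducedGrading 𝒜 R M).comp k) :
    f x ∈ (inducedGrading 𝒜 R M).comp (k * g) := by
  have : inducedComp 𝒜 R M k ≤ ((inducedGrading 𝒜 R M).comp (k * g)).comap f.toAddMonoidHom := by
    refine (AddSubgroup.closure_le _).mpr ?_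
    rintro _ ⟨a, ha, m, rfl⟩
    change f (bimoduleTmul A R a m) ∈ (inducedGrading 𝒜 R M).comp (k * g)
    rw [tmul_eq_smul, map_smul]
    exact (inducedGrading 𝒜 R M).smul_mem ha (hf m)
  exact this hx

end Induced

namespace RingGrading

/-! ### Epsilon-strong gradings -/

section EpsilonStrong

variable {G : Type w} {A : Type u} [Group G] [Ring A] {𝒜 : RingGrading G A} {ε : G → A}

theorem exists_sum_of_mem_addSubgroupMul {X Y : AddSubgroup A} {z : A}
    (hz : z ∈ addSubgroupMul X Y) :
    ∃ (n : ℕ) (a b : Fin n → A), (∀ k, a k ∈ X) ∧ (∀ k, b k ∈ Y) ∧ z = ∑ k, a k * b k := by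
  induction hz using AddSubgroup.closure_induction with
  | mem z hz =>
    obtain ⟨x, hx, y, hy, rfl⟩ := hz
    exact ⟨1, fun _ => x, fun _ => y, fun _ => hx, fun _ => hy, by simp⟩
  | zero => exact ⟨0, fun _ => 0, fun _ => 0, fun k => k.elim0, fun k => k.elim0, by simp⟩
  | add x y _ _ hx hy =>
    obtain ⟨n, a, b, ha, hb, rfl⟩ := hx
    obtain ⟨m, c, d, hc, hd, rfl⟩ := hy
    refine ⟨n + m, Fin.append a c, Fin.append b d, fun k => ?_, fun k => ?_,
      by simp [Fin.sum_univ_add]⟩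
    · induction k using Fin.addCases <;> simp [ha, hc]
    · induction k using Fin.addCases <;> simp [hb, hd]
  | neg x _ hx =>
    obtain ⟨n, a, b, ha, hb, rfl⟩ := hx
    exact ⟨n, fun k => -a k, b, fun k => neg_mem (ha k), hb, by simp⟩

variable (hε : 𝒜.IsEpsilonStrong ε)
include hε

theorem IsEpsilonStrong.exists_sum (g : G) :
    ∃ (n : ℕ) (a b : Fin n → A), (∀ k, a k ∈ 𝒜.comp g) ∧ (∀ k, b k ∈ 𝒜.comp g⁻¹) ∧
      ε g = ∑ k, a k * b k :=
  exists_sum_of_mem_addSubgroupMul (hε.mem g)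

theorem IsEpsilonStrong.mem_one (g : G) : ε g ∈ 𝒜.comp 1 := by
  obtain ⟨n, a, b, ha, hb, h⟩ := hε.exists_sum g
  rw [h]
  refine sum_mem fun k _ => ?_
  have := 𝒜.mul_mem (ha k) (hb k)
  rwa [mul_inv_cancel] at this

theorem IsEpsilonStrong.eq_zero {g : G} (hg : 𝒜.comp g = ⊥) : ε g = 0 := by
  obtain ⟨n, a, b, ha, hb, h⟩ := hε.exists_sum g
  rw [h]
  refine Finset.sum_eq_zero fun k _ => ?_
  have := ha k
  rw [hg, AddSubgroup.mem_bot] at this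
  rw [this, zero_mul]

theorem IsEpsilonStrong.comp_inv_eq_bot {g : G} (hg : 𝒜.comp g = ⊥) : 𝒜.comp g⁻¹ = ⊥ := by
  rw [eq_bot_iff]
  intro x hx
  rw [AddSubgroup.mem_bot, ← hε.right_unital _ x hx, inv_inv, hε.eq_zero hg, mul_zero]

/-- An element of degree `g` is determined by its products with the elements of degree `g⁻¹`. -/
theorem IsEpsilonStrong.unit_smul_eq_zero {g : G} {N : Type*} [AddCommGroup N] [Module A N] {x : N}
    (hx : ∀ b ∈ 𝒜.comp g⁻¹, b • x = 0) : ε g • x = 0 := by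
  obtain ⟨n, a, b, -, hb, h⟩ := hε.exists_sum g
  rw [h, Finset.sum_smul]
  refine Finset.sum_eq_zero fun k _ => ?_
  rw [mul_smul, hx _ (hb k), smul_zero]

end EpsilonStrong

/-! ### Graded endomorphisms of modules induced from invariant modules -/

section Invariant

variable {G : Type w} {A : Type u} [Group G] [Ring A] {𝒜 : RingGrading G A} {ε : G → A}
  {P : Type v} [AddCommGroup P] [Module 𝒜.base P]

theorem rightElt_base (r : 𝒜.base) : rightElt A r = (r : A) := one_mul _

variable (𝒜 P) in
/-- The natural map `A_g ⊗_R P → A ⊗_R P`, with `R = A_1`, is injective with image `(A ⊗_R P)_g`. -/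
theorem exists_compTensor_embedding (g : G) :
    ∃ j : 𝒜.compTensor g P →+ BimoduleTensor A 𝒜.base A P, Function.Injective j ∧
      (∀ (r : 𝒜.base) x, j (r • x) = (r : A) • j x) ∧
      ∀ x, x ∈ (inducedGrading 𝒜 𝒜.base P).comp g ↔ ∃ y, j y = x := by
  obtain ⟨j, hj⟩ := exists_bimoduleLift 𝒜.base (R := 𝒜.base) (P := 𝒜.comp g) (M := P)
    { toFun := fun a => tmulRight A 𝒜.base A P (a : A)
      map_zero' := by ext m; exact zero_bimoduleTmul m
      map_add' := fun a b => by ext m; exact add_bimoduleTmul (a : A) (b : A) m }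
    (fun a r m => op_smul_bimoduleTmul (a : A) r m)
  replace hj : ∀ a m, j (bimoduleTmul 𝒜.base 𝒜.base a m) = bimoduleTmul A 𝒜.base (a : A) m := hj
  have hmem : ∀ y, j y ∈ (inducedGrading 𝒜 𝒜.base P).comp g := by
    intro y
    induction y using bimoduleTensor_induction with
    | zero => rw [map_zero]; exact zero_mem _
    | add x y hx hy => rw [map_add]; exact add_mem hx hy
    | tmul a m => rw [hj]; exact tmul_mem_inducedComp 𝒜 a.2 m
  obtain ⟨π, h1, h2⟩ := exists_projection 𝒜.comp 𝒜.indep 𝒜.iSup_eq_top g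
  have hπ : ∀ a, π a ∈ 𝒜.comp g := by
    intro a
    have ha : a ∈ ⨆ k, 𝒜.comp k := by rw [𝒜.iSup_eq_top]; trivial
    induction ha using AddSubgroup.iSup_induction' with
    | h1 => rw [map_zero]; exact zero_mem _
    | hadd x y _ _ hx hy => rw [map_add]; exact add_mem hx hy
    | hp k x hx =>
      by_cases hk : k = g
      · subst hk; rwa [h1 x hx]
      · rw [h2 k hk x hx]; exact zero_mem _
  have hπr : ∀ a (r : 𝒜.base), π (a * (r : A)) = π a * r := by
    intro a r
    have ha : a ∈ ⨆ k, 𝒜.comp k := by rw [𝒜.iSup_eq_top]; trivial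
    induction ha using AddSubgroup.iSup_induction' with
    | h1 => simp
    | hadd x y _ _ hx hy => simp only [add_mul, map_add, hx, hy]
    | hp k x hx =>
      have hx' := RightStable.smul_mem (𝒜 := 𝒜) k r x hx
      rw [op_smul_eq] at hx'
      by_cases hk : k = g
      · subst hk; rw [h1 x hx, h1 _ hx']
      · rw [h2 k hk x hx, h2 k hk _ hx', zero_mul]
  -- The projection onto `A_g` induces a left inverse.
  obtain ⟨ρ, hρ⟩ := exists_bimoduleLift A (R := 𝒜.base) (P := A) (M := P)
    (N := 𝒜.compTensor g P)
    { toFun := fun a => tmulRight 𝒜.base 𝒜.base (𝒜.comp g) P ⟨π a, hπ a⟩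
      map_zero' := by
        ext m
        change bimoduleTmul _ _ _ _ = 0
        refine Eq.trans ?_ (zero_bimoduleTmul (S := 𝒜.base) (R := 𝒜.base) (P := 𝒜.comp g) m)
        congr 1
        exact Subtype.ext (map_zero π)
      map_add' := fun a b => by
        ext m
        refine Eq.trans ?_ (add_bimoduleTmul (S := 𝒜.base) (R := 𝒜.base) (P := 𝒜.comp g)
          ⟨π a, hπ a⟩ ⟨π b, hπ b⟩ m)
        change bimoduleTmul _ _ _ _ = bimoduleTmul _ _ _ _
        congr 1
        exact Subtype.ext (map_add π a b) }
    (fun a r m => by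
      change bimoduleTmul _ _ _ m = bimoduleTmul _ _ _ (r • m)
      rw [← op_smul_bimoduleTmul]
      congr 1
      exact Subtype.ext (hπr a r))
  refine ⟨j, ?_, ?_, fun x => ⟨fun hx => ?_, ?_⟩⟩
  · refine Function.LeftInverse.injective (g := ρ) fun y => ?_
    induction y using bimoduleTensor_induction with
    | zero => rw [map_zero, map_zero]
    | add x y hx hy => rw [map_add, map_add, hx, hy]
    | tmul a m =>
      rw [hj, hρ]
      change bimoduleTmul _ _ _ m = _
      congr 1
      exact Subtype.ext (h1 _ a.2)
  · intro r x
    induction x using bimoduleTensor_induction with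
    | zero => simp
    | add x y hx hy => rw [smul_add, map_add, map_add, smul_add, hx, hy]
    | tmul a m => rw [smul_bimoduleTmul, hj, hj]; rfl
  · change x ∈ AddSubgroup.closure _ at hx
    have : inducedComp 𝒜 𝒜.base P g ≤ j.range := by
      refine (AddSubgroup.closure_le _).mpr ?_
      rintro _ ⟨a, ha, m, rfl⟩
      exact ⟨bimoduleTmul _ _ ⟨a, ha⟩ m, hj _ _⟩
    exact this hx
  · rintro ⟨y, rfl⟩
    exact hmem y

theorem exists_eq_one_tmul {x : BimoduleTensor A 𝒜.base A P}
    (hx : x ∈ (inducedGrading 𝒜 𝒜.base P).comp 1) :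
    ∃ q, x = bimoduleTmul A 𝒜.base 1 q := by
  have : inducedComp 𝒜 𝒜.base P 1 ≤ (tmulRight A 𝒜.base A P 1).range := by
    refine (AddSubgroup.closure_le _).mpr ?_
    rintro _ ⟨a, ha, m, rfl⟩
    refine ⟨(⟨a, ha⟩ : 𝒜.base) • m, ?_⟩
    change bimoduleTmul A 𝒜.base 1 _ = _
    rw [← op_smul_bimoduleTmul, op_smul_eq, one_mul]
  obtain ⟨q, hq⟩ := this hx
  exact ⟨q, hq.symm⟩

/-- The graded endomorphism ring of the module induced from a `G`-invariant module `P` is a partial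
crossed product. An isomorphism `P ≃ A_g ⊗ P` extends to an endomorphism of degree `g` of `A ⊗ P`.
It is onto because the local identity of `A_{g⁻¹}` acts trivially on `P`. -/
theorem isPartialCrossedProduct_of_isInvariantModule (hε : 𝒜.IsEpsilonStrong ε)
    (hP : 𝒜.IsInvariantModule P) :
    IsPartialCrossedProduct (inducedGrading 𝒜 𝒜.base P).endGrading := by
  refine ModuleGrading.isPartialCrossedProduct_endGrading _ fun g => ?_
  have hunit : ∀ h, 𝒜.comp h ≠ ⊥ → ∀ q : P, (⟨ε h, hε.mem_one h⟩ : 𝒜.base) • q = q := by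
    intro h hh q
    obtain ⟨Ψ⟩ := hP h hh
    obtain ⟨x, rfl⟩ := Ψ.surjective q
    rw [← map_smul]
    congr 1
    induction x using bimoduleTensor_induction with
    | zero => rw [smul_zero]
    | add x y hx hy => rw [smul_add, hx, hy]
    | tmul a m =>
      rw [smul_bimoduleTmul]
      congr 1
      exact Subtype.ext (hε.left_unital h a a.2)
  have hunit' : ∀ h, ∀ x ∈ (inducedGrading 𝒜 𝒜.base P).comp h, ε h • x = x := by
    intro h x hx
    have : inducedComp 𝒜 𝒜.base P h ≤ AddMonoidHom.eqLocus
        (DistribSMul.toAddMonoidHom (BimoduleTensor A 𝒜.base A P) (ε h)) (AddMonoidHom.id _) := by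
      refine (AddSubgroup.closure_le _).mpr ?_
      rintro _ ⟨a, ha, m, rfl⟩
      change ε h • bimoduleTmul A 𝒜.base a m = _
      rw [smul_bimoduleTmul, smul_eq_mul, hε.left_unital h a ha]; rfl
    exact this hx
  by_cases hg : 𝒜.comp g = ⊥
  · left
    intro f hf
    refine inducedHom_ext fun m => ?_
    have h1 := hf 1 _ (tmul_mem_inducedComp 𝒜 𝒜.one_mem m)
    rw [one_mul] at h1
    rw [LinearMap.zero_apply, ← hunit' g _ h1, hε.eq_zero hg, zero_smul]
  right
  have hg' : 𝒜.comp g⁻¹ ≠ ⊥ := fun h => hg (inv_inv g ▸ hε.comp_inv_eq_bot h)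
  obtain ⟨Ψ⟩ := hP g hg
  obtain ⟨j, hj, hjr, hjm⟩ := exists_compTensor_embedding 𝒜 P g
  obtain ⟨u, hu⟩ := exists_inducedHom (A := A) (R := 𝒜.base) (j.comp Ψ.symm.toLinearMap.toAddMonoidHom) (fun r m => by
    change j (Ψ.symm (r • m)) = _ • j (Ψ.symm m)
    rw [map_smul, hjr, rightElt_base])
  replace hu : ∀ m, u (bimoduleTmul A 𝒜.base 1 m) = j (Ψ.symm m) := hu
  have hdeg := map_mem_inducedComp 𝒜 (f := u) (g := g) fun m => by
    rw [hu, hjm]; exact ⟨_, rfl⟩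
  have hinj : Function.Injective u := by
    refine (inducedGrading 𝒜 𝒜.base P).injective_of_homogeneous hdeg fun h x hx hx0 => ?_
    rw [← hunit' h x hx]
    refine hε.unit_smul_eq_zero fun b hb => ?_
    have h1 := (inducedGrading 𝒜 𝒜.base P).smul_mem hb hx
    rw [inv_mul_cancel] at h1
    obtain ⟨q, hq⟩ := exists_eq_one_tmul h1
    have h2 : j (Ψ.symm q) = 0 := by rw [← hu, ← hq, map_smul, hx0, smul_zero]
    rw [map_eq_zero_iff j hj, map_eq_zero_iff _ Ψ.symm.injective] at h2
    rw [hq, h2]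
    exact map_zero (tmulRight A 𝒜.base A P 1)
  have hsurj : Function.Surjective u := by
    rw [← LinearMap.range_eq_top, eq_top_iff]
    rintro x -
    induction x using bimoduleTensor_induction with
    | zero => exact zero_mem _
    | add x y hx hy => exact add_mem hx hy
    | tmul a m =>
      rw [tmul_eq_smul]
      refine Submodule.smul_mem _ _ ?_
      obtain ⟨n, c, b, -, hb, h⟩ := hε.exists_sum g⁻¹
      rw [← hunit g⁻¹ hg' m, ← rightElt_smul_tmul, rightElt_base]
      change ε g⁻¹ • _ ∈ _
      rw [h, Finset.sum_smul]
      refine sum_mem fun k _ => ?_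
      rw [mul_smul]
      refine Submodule.smul_mem _ _ ?_
      obtain ⟨y, hy⟩ := (hjm _).mp (tmul_mem_inducedComp (R := 𝒜.base) 𝒜 (inv_inv g ▸ hb k) m)
      refine ⟨bimoduleTmul A 𝒜.base 1 (Ψ y), ?_⟩
      rw [hu, Ψ.symm_apply_apply, hy, ← tmul_eq_smul]
  exact ⟨LinearEquiv.ofBijective u ⟨hinj, hsurj⟩, hdeg⟩

end Invariant

end RingGrading

/-! ### Primitive idempotents of semiperfect rings -/

section Ring

variable {R : Type*} [Ring R]

theorem exists_mul_mul_eq_self [IsSemisimpleRing R] (x : R) : ∃ y, x * y * x = x := by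
  obtain ⟨V, hV⟩ := exists_isCompl (Submodule.span R {x})
  have h1 : (1 : R) ∈ Submodule.span R {x} ⊔ V := by rw [hV.sup_eq_top]; trivial
  obtain ⟨a, ha, v, hv, hav⟩ := Submodule.mem_sup.mp h1
  obtain ⟨y, rfl⟩ := Submodule.mem_span_singleton.mp ha
  refine ⟨y, ?_⟩
  have h2 : x = x * y * x + x * v := by
    rw [mul_assoc, ← mul_add, ← smul_eq_mul y, hav, mul_one]
  have h3 : x * v ∈ Submodule.span R {x} := by
    have : x * v = (1 - x * y) • x := by
      rw [sub_smul, one_smul, smul_eq_mul, eq_sub_iff_add_eq, add_comm]; exact h2.symm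
    rw [this]
    exact Submodule.smul_mem _ _ (Submodule.mem_span_singleton_self x)
  have h4 : x * v = 0 := Submodule.disjoint_def.mp hV.disjoint _ h3 (V.smul_mem x hv)
  rw [h4, add_zero] at h2
  exact h2.symm

theorem isUnit_one_sub_of_mem_jacobson {j : R} (hj : j ∈ Ring.jacobson R) : IsUnit (1 - j) := by
  have key : ∀ j ∈ Ring.jacobson R, ∃ c, c * (1 - j) = 1 := by
    intro j hj
    by_contra h
    have h1 : Ideal.span {1 - j} ≠ (⊤ : Ideal R) := fun h' => by
      have : (1 : R) ∈ Ideal.span {1 - j} := by rw [h']; trivial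
      exact h (Ideal.mem_span_singleton'.mp this)
    obtain ⟨I, hI, hle⟩ := Ideal.exists_le_maximal _ h1
    refine hI.ne_top ((Ideal.eq_top_iff_one I).mpr ?_)
    have h2 := I.add_mem (hle (Ideal.mem_span_singleton_self _))
      (Ring.jacobson_le_of_isMaximal I hj)
    rwa [sub_add_cancel] at h2
  obtain ⟨c, hc⟩ := key j hj
  obtain ⟨d, hd⟩ := key (-(c * j)) (neg_mem (Ideal.mul_mem_left _ c hj))
  have h1 : 1 - -(c * j) = c := by
    rw [mul_sub, mul_one, sub_eq_iff_eq_add] at hc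
    rw [sub_neg_eq_add]
    exact hc.symm
  rw [h1] at hd
  have h2 : d = 1 - j := by
    calc d = d * (c * (1 - j)) := by rw [hc, mul_one]
      _ = 1 - j := by rw [← mul_assoc, hd, one_mul]
  exact ⟨⟨1 - j, c, h2 ▸ hd, hc⟩, rfl⟩

theorem IsIdempotentElem.eq_zero_of_mem_jacobson {f : R} (hf : IsIdempotentElem f)
    (hj : f ∈ Ring.jacobson R) : f = 0 := by
  rw [← (isUnit_one_sub_of_mem_jacobson hj).mul_left_eq_zero, mul_sub, mul_one, hf.eq, sub_self]

theorem IsPrimitiveIdempotent.eq_zero_or_eq {e f : R} (he : IsPrimitiveIdempotent e)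
    (hf : IsIdempotentElem f) (hef : e * f = f) (hfe : f * e = f) : f = 0 ∨ f = e := by
  have h1 : IsIdempotentElem (e - f) := by
    change (e - f) * (e - f) = e - f
    rw [sub_mul, mul_sub, mul_sub, he.idem.eq, hef, hfe, hf.eq, sub_self, sub_zero]
  have h2 : f * (e - f) = 0 := by rw [mul_sub, hfe, hf.eq, sub_self]
  have h3 : (e - f) * f = 0 := by rw [sub_mul, hef, hf.eq, sub_self]
  rcases he.eq_zero_or f (e - f) hf h1 h2 h3 (add_sub_cancel _ _).symm with h | h
  · exact Or.inl h
  · exact Or.inr (sub_eq_zero.mp h).symm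

/-- A form of the fact that, in a semiperfect ring, the corner ring `eRe` of a primitive idempotent
`e` is local: an element of `eR` is zero modulo the Jacobson radical, or it divides `e` from the
left modulo the radical. -/
theorem IsSemiperfectRing.mem_jacobson_or (hR : IsSemiperfectRing R) {e a : R}
    (he : IsPrimitiveIdempotent e) (hea : e * a = a) :
    a ∈ Ring.jacobson R ∨ ∃ b, a * b - e ∈ Ring.jacobson R := by
  have := hR.isSemisimpleRing
  set J := Ring.jacobson R
  let q := Ideal.Quotient.mk J
  obtain ⟨y, hy⟩ := exists_mul_mul_eq_self (q a)
  obtain ⟨b, rfl⟩ := Ideal.Quotient.mk_surjective y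
  -- `a b e` is idempotent modulo `J`; it is lifted to an idempotent `g`, and then to one in `eRe`.
  have h1 : IsIdempotentElem (q (a * b * e)) := by
    change q _ * q _ = _
    rw [← map_mul, show a * b * e * (a * b * e) = a * b * (e * a) * b * e by simp only [mul_assoc],
      hea, map_mul, map_mul, map_mul, map_mul, hy, ← map_mul, ← map_mul]
  obtain ⟨g, hg, hgq⟩ := hR.lift_idempotent _ h1
  have hj : g - g * e ∈ J := by
    rw [← Ideal.Quotient.eq_zero_iff_mem, map_sub, map_mul, hgq, sub_eq_zero]
    change q _ = q _ * q _
    rw [← map_mul, mul_assoc _ e, he.idem.eq]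
  obtain ⟨c, hc⟩ := isUnit_one_sub_of_mem_jacobson hj
  have h2 : g * c = g * e := by
    rw [hc, mul_sub, mul_one, mul_sub, ← mul_assoc, hg.eq, sub_sub_cancel]
  -- The conjugate `c⁻¹ g c` of `g` lies in `Re`.
  obtain ⟨f', hf'⟩ : ∃ f', f' = ↑c⁻¹ * g * (c : R) := ⟨_, rfl⟩
  have h3 : f' * e = f' := by
    rw [hf', mul_assoc _ g, h2, mul_assoc, mul_assoc, he.idem.eq]
  have h4 : f' * f' = f' := by
    rw [hf']
    calc _ = ↑c⁻¹ * g * (↑c * ↑c⁻¹) * g * (c : R) := by simp only [mul_assoc]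
      _ = _ := by rw [c.mul_inv, mul_one, mul_assoc _ g g, hg.eq]
  have hqc : q (c : R) = 1 := by
    rw [hc, map_sub, map_one, Ideal.Quotient.eq_zero_iff_mem.mpr hj, sub_zero]
  have hqc' : q ((c⁻¹ : Rˣ) : R) = 1 := by
    calc q ((c⁻¹ : Rˣ) : R) = q (c⁻¹ : Rˣ) * q (c : R) := by rw [hqc, mul_one]
      _ = 1 := by rw [← map_mul, c.inv_mul, map_one]
  have h5 : q f' = q (a * b * e) := by
    rw [hf', map_mul, map_mul, hqc, hqc', one_mul, mul_one]
    exact hgq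
  have h6 : IsIdempotentElem (e * f') := by
    change e * f' * (e * f') = e * f'
    rw [mul_assoc, ← mul_assoc f', h3, h4]
  have h7 : q (e * f') = q (a * b * e) := by
    rw [map_mul, h5, ← map_mul, ← mul_assoc, ← mul_assoc, hea]
  rcases he.eq_zero_or_eq h6 (by rw [← mul_assoc, he.idem.eq]) (by rw [mul_assoc, h3]) with h | h
  · left
    rw [← Ideal.Quotient.eq_zero_iff_mem]
    change q a = 0
    rw [← hy, ← map_mul, ← hea, ← map_mul, ← mul_assoc, map_mul, hea, ← h7, h, map_zero, zero_mul]
  · right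
    refine ⟨b * e, ?_⟩
    rw [← Ideal.Quotient.eq_zero_iff_mem, map_sub, sub_eq_zero, ← mul_assoc]
    change q _ = q _
    rw [← h7, h]

end Ring

/-! ### Indecomposable projective modules -/

section Indecomposable

variable {R : Type u} [Ring R]

theorem IsIndecomposableModule.of_idempotent {M : Type*} [AddCommGroup M] [Module R M]
    [Nontrivial M] (h : ∀ f : M →ₗ[R] M, f ∘ₗ f = f → f = 0 ∨ f = LinearMap.id) :
    IsIndecomposableModule R M := by
  refine ⟨inferInstance, fun U V hUV => ?_⟩
  have hU := Submodule.range_projection hUV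
  have hV := Submodule.ker_projection hUV
  rcases h _ (Submodule.isIdempotentElem_projection hUV) with h0 | h0
  · left
    rw [← hU, h0, LinearMap.range_zero]
  · right
    rw [← hV, h0, LinearMap.ker_id]

theorem IsIndecomposableModule.of_equiv {M N : Type*} [AddCommGroup M] [Module R M]
    [AddCommGroup N] [Module R N] (φ : M ≃ₗ[R] N) (hM : IsIndecomposableModule R M) :
    IsIndecomposableModule R N := by
  have := hM.nontrivial
  refine ⟨φ.symm.toEquiv.nontrivial, fun U V hUV => ?_⟩
  rcases hM.eq_bot_or _ _ ((Submodule.orderIsoMapComap φ.symm).isCompl hUV) with h | h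
  · exact Or.inl ((map_eq_bot_iff _).mp h)
  · exact Or.inr ((map_eq_bot_iff _).mp h)

theorem mem_leftIdeal_iff {e x : R} (he : IsIdempotentElem e) : x ∈ leftIdeal e ↔ x * e = x := by
  rw [Submodule.mem_span_singleton]
  constructor
  · rintro ⟨a, rfl⟩
    rw [smul_eq_mul, mul_assoc, he.eq]
  · exact fun h => ⟨x, h⟩

theorem leftIdeal_projective {e : R} (he : IsIdempotentElem e) :
    Module.Projective R (leftIdeal e) := by
  refine Module.Projective.of_split (leftIdeal e).subtype
    ((LinearMap.toSpanSingleton R R e).codRestrict _ fun x =>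
      Submodule.smul_mem _ x (Submodule.mem_span_singleton_self e)) ?_
  ext x
  exact (mem_leftIdeal_iff he).mp x.2

theorem IsPrimitiveIdempotent.isIndecomposableModule {e : R} (he : IsPrimitiveIdempotent e) :
    IsIndecomposableModule R (leftIdeal e) := by
  let e' : leftIdeal e := ⟨e, Submodule.mem_span_singleton_self e⟩
  have : Nontrivial (leftIdeal e) := ⟨e', 0, fun h => he.ne_zero (congrArg Subtype.val h)⟩
  have hx : ∀ x : leftIdeal e, x = (x : R) • e' := fun x =>
    Subtype.ext ((mem_leftIdeal_iff he.idem).mp x.2).symm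
  refine .of_idempotent fun p hp => ?_
  have h1 : IsIdempotentElem (p e' : R) := by
    have h2 : p (p e') = p e' := LinearMap.congr_fun hp e'
    rw [hx (p e'), map_smul] at h2
    exact (congrArg Subtype.val h2).trans (congrArg Subtype.val (hx (p e')).symm)
  have h2 : e * (p e' : R) = p e' := by
    have : e • p e' = p e' := by
      rw [← map_smul]
      exact congrArg p (hx e').symm
    exact congrArg Subtype.val this
  rcases he.eq_zero_or_eq h1 h2 ((mem_leftIdeal_iff he.idem).mp (p e').2) with h | h
  · left
    ext x
    rw [hx x, map_smul, show p e' = 0 from Subtype.ext h, smul_zero]; rfl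
  · right
    ext x
    rw [hx x, map_smul, show p e' = e' from Subtype.ext h]; rfl

variable {n : ℕ} {e : Fin n → R}

/-- The classification of the indecomposable projective modules by a basic set, for finitely
generated modules in any universe. -/
theorem IsBasicSet.exists_equiv (he : IsBasicSet e) {M : Type*} [AddCommGroup M] [Module R M]
    [Module.Finite R M] [Module.Projective R M] (hM : IsIndecomposableModule R M) :
    ∃ i, Nonempty (M ≃ₗ[R] leftIdeal (e i)) := by
  obtain ⟨k, q, hq⟩ := Module.Finite.exists_fin' R M
  let φ := q.quotKerEquivOfSurjective hq
  obtain ⟨i, ⟨ψ⟩⟩ := he.complete _ (Module.Projective.of_equiv φ.symm) (.of_equiv φ.symm hM)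
  exact ⟨i, ⟨φ.symm.trans ψ⟩⟩

/-- Over a semiperfect ring, the direct sum of the modules `R eᵢ` of a basic set is a
progenerator. By induction on the left ideal generated in `R / J(R)`, every idempotent is a sum of
values of linear forms on this module. -/
theorem IsBasicSet.isProgenerator (hR : IsSemiperfectRing R) (he : IsBasicSet e) :
    IsProgenerator R (sumLeftIdeals e Set.univ) := by
  classical
  have := hR.isSemisimpleRing
  have hproj : ∀ i : (Set.univ : Set (Fin n)), Module.Projective R (leftIdeal (e i)) := fun i =>
    leftIdeal_projective (he.primitive i).idem
  let Q := sumLeftIdeals e Set.univ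
  let S := R ⧸ Ring.jacobson R
  let q := Ideal.Quotient.mk (Ring.jacobson R)
  have key : ∀ f : R, IsIdempotentElem f → ∃ (k : ℕ) (φ : Fin k → Q →ₗ[R] R) (m : Fin k → Q),
      f = ∑ i, φ i (m i) := by
    intro f
    induction f using (InvImage.wf (fun f => Submodule.span S {q f})
      (wellFounded_lt (α := Submodule S S))).induction with
    | _ f ih =>
    intro hf
    by_cases h0 : f = 0
    · exact ⟨0, fun _ => 0, fun _ => 0, by simpa using h0⟩
    by_cases hp : IsPrimitiveIdempotent f
    · have := leftIdeal_projective hf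
      obtain ⟨i, ⟨ψ⟩⟩ := he.exists_equiv hp.isIndecomposableModule
      refine ⟨1, fun _ => (leftIdeal f).subtype ∘ₗ ψ.symm.toLinearMap ∘ₗ
        DirectSum.component R _ (fun i : (Set.univ : Set (Fin n)) => leftIdeal (e i)) ⟨i, trivial⟩,
        fun _ => DirectSum.lof R _ (fun i : (Set.univ : Set (Fin n)) => leftIdeal (e i))
          ⟨i, trivial⟩ (ψ ⟨f, Submodule.mem_span_singleton_self f⟩), ?_⟩
      rw [Fin.sum_univ_one, LinearMap.comp_apply, LinearMap.comp_apply, DirectSum.component.lof_self]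
      change f = (ψ.symm (ψ _) : leftIdeal f)
      rw [ψ.symm_apply_apply]
    · have : ∃ f₁ f₂ : R, IsIdempotentElem f₁ ∧ IsIdempotentElem f₂ ∧ f₁ * f₂ = 0 ∧ f₂ * f₁ = 0 ∧
          f = f₁ + f₂ ∧ f₁ ≠ 0 ∧ f₂ ≠ 0 := by
        by_contra hcon
        refine hp ⟨hf, h0, fun f₁ f₂ h1 h2 h3 h4 h5 => ?_⟩
        by_contra h6
        rw [not_or] at h6
        exact hcon ⟨f₁, f₂, h1, h2, h3, h4, h5, h6⟩
      obtain ⟨f₁, f₂, h1, h2, h3, h4, h5, h6, h7⟩ := this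
      have hlt : ∀ a b : R, IsIdempotentElem a → IsIdempotentElem b → a * b = 0 → f = a + b →
          b ≠ 0 → Submodule.span S {q a} < Submodule.span S {q f} := by
        intro a b ha hb hab hfab hb0
        refine lt_of_le_not_ge ?_ fun hle => hb0 (hb.eq_zero_of_mem_jacobson ?_)
        · rw [Submodule.span_singleton_le_iff_mem, Submodule.mem_span_singleton]
          refine ⟨q a, ?_⟩
          rw [smul_eq_mul, ← map_mul, hfab, mul_add, ha.eq, hab, add_zero]
        · rw [Submodule.span_singleton_le_iff_mem, Submodule.mem_span_singleton] at hle
          obtain ⟨r, hr⟩ := hle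
          rw [← Ideal.Quotient.eq_zero_iff_mem]
          change q b = 0
          have h8 : q f * q b = q b := by
            rw [← map_mul, hfab, add_mul, hab, hb.eq, zero_add]
          rw [← h8, ← hr, smul_eq_mul, mul_assoc, ← map_mul, hab, map_zero, mul_zero]
      obtain ⟨k₁, φ₁, m₁, hs₁⟩ := ih f₁ (hlt f₁ f₂ h1 h2 h3 h5 h7) h1
      obtain ⟨k₂, φ₂, m₂, hs₂⟩ := ih f₂ (hlt f₂ f₁ h2 h1 h4 (h5.trans (add_comm _ _)) h6) h2
      refine ⟨k₁ + k₂, Fin.append φ₁ φ₂, Fin.append m₁ m₂, ?_⟩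
      simp only [Fin.sum_univ_add, Fin.append_left, Fin.append_right]
      rw [h5, hs₁, hs₂]
  obtain ⟨k, φ, m, hs⟩ := key 1 IsIdempotentElem.one
  refine ⟨inferInstance, inferInstance, k, ∑ i, φ i ∘ₗ LinearMap.proj i, fun r => ⟨r • m, ?_⟩⟩
  rw [map_smul, LinearMap.sum_apply]
  simp only [LinearMap.comp_apply, LinearMap.proj_apply]
  rw [← hs, smul_eq_mul, mul_one]

/-- Tensoring `R eᵢ` with a partially invertible bimodule `P` gives zero or some `R eⱼ`. The module
`P ⊗ R eᵢ` is a direct summand of `P`; an idempotent endomorphism of it is the right multiplication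
by an element of the local ring `eᵢ R eᵢ`, hence trivial. -/
theorem IsPartiallyInvertible.subsingleton_or_equiv (hR : IsSemiperfectRing R) (he : IsBasicSet e)
    {P : Type*} [AddCommGroup P] [Module R P] [Module Rᵐᵒᵖ P] [SMulCommClass R Rᵐᵒᵖ P]
    (hP : IsPartiallyInvertible R P) (i : Fin n) :
    Subsingleton (BimoduleTensor R R P (leftIdeal (e i))) ∨
      ∃ j, Nonempty (BimoduleTensor R R P (leftIdeal (e i)) ≃ₗ[R] leftIdeal (e j)) := by
  have hi := he.primitive i
  set ei := e i
  let M := BimoduleTensor R R P (leftIdeal ei)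
  let ei' : leftIdeal ei := ⟨ei, Submodule.mem_span_singleton_self ei⟩
  rcases subsingleton_or_nontrivial M with hM | hM
  · exact Or.inl hM
  right
  -- `π x = x ⊗ eᵢ` and `ι (x ⊗ r) = x r` present `M` as a direct summand of `P`.
  let π : P →ₗ[R] M := tmulLeft R R P ei'
  obtain ⟨ι, hι⟩ : ∃ ι : M →ₗ[R] P, ∀ x (r : leftIdeal ei),
      ι (bimoduleTmul R R x r) = MulOpposite.op (r : R) • x := by
    refine exists_bimoduleLift_linear (S := R) (R := R) (P := P) (M := leftIdeal ei) (N := P)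
      { toFun := fun x =>
          { toFun := fun r => MulOpposite.op (r : R) • x
            map_zero' := by simp
            map_add' := fun r s => by simp [add_smul] }
        map_add' := fun x y => by ext r; exact smul_add _ x y
        map_smul' := fun s x => by ext r; exact (smul_comm s (MulOpposite.op (r : R)) x).symm }
      fun x s r => ?_
    change MulOpposite.op (r : R) • MulOpposite.op s • x = MulOpposite.op (s * (r : R)) • x
    rw [MulOpposite.op_mul, mul_smul]
  have hπι : π ∘ₗ ι = LinearMap.id := by
    refine LinearMap.ext fun x => ?_
    induction x using bimoduleTensor_induction with
    | zero => rw [map_zero, map_zero]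
    | add x y hx hy => rw [map_add, map_add, hx, hy]
    | tmul x r =>
      rw [LinearMap.comp_apply, hι]
      change bimoduleTmul R R (MulOpposite.op (r : R) • x) ei' = _
      rw [op_smul_bimoduleTmul]
      congr 1
      exact Subtype.ext ((mem_leftIdeal_iff hi.idem).mp r.2)
  have hιπ : ∀ x, ι (π x) = MulOpposite.op ei • x := fun x => hι x ei'
  have hπι' : ∀ x, π (ι x) = x := LinearMap.congr_fun hπι
  have := hP.finite_left
  have := hP.projective_left
  have : Module.Finite R M := .of_surjective π (LinearMap.surjective_of_comp_eq_id _ _ hπι)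
  have : Module.Projective R M := .of_split ι π hπι
  refine he.exists_equiv (.of_idempotent fun f hf => ?_)
  have hff : ∀ x, f (f x) = f x := LinearMap.congr_fun hf
  obtain ⟨a₀, ha₀⟩ := hP.right_surjective (ι ∘ₗ f ∘ₗ π)
  replace ha₀ : ∀ x, ι (f (π x)) = MulOpposite.op a₀ • x := ha₀
  have hop : ∀ (r s : R) (x : P),
      MulOpposite.op r • MulOpposite.op s • x = MulOpposite.op (s * r) • x := fun r s x => by
    rw [MulOpposite.op_mul, mul_smul]
  obtain ⟨a, ha⟩ : ∃ a, a = ei * a₀ * ei := ⟨_, rfl⟩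
  have hea : ei * a = a := by rw [ha, ← mul_assoc, ← mul_assoc, hi.idem.eq]
  have hae : a * ei = a := by rw [ha, mul_assoc, hi.idem.eq]
  have hfa : ∀ x, ι (f (π x)) = MulOpposite.op a • x := by
    intro x
    rw [ha, ← hop, ← hop, ← hιπ x, ← ha₀, hπι', ← hιπ, hπι']
  have haa : ∀ x : P, MulOpposite.op (a * a) • x = MulOpposite.op a • x := by
    intro x
    rw [← hop, ← hfa, ← hfa, hπι', hff]
  rcases hR.mem_jacobson_or hi hea with hJ | ⟨b, hb⟩
  · left
    obtain ⟨c, hc⟩ := isUnit_one_sub_of_mem_jacobson hJ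
    have h1 : ∀ x : P, MulOpposite.op a • x = 0 := by
      intro x
      have h2 : MulOpposite.op (a * (c : R)) • x = 0 := by
        rw [hc, mul_sub, mul_one, MulOpposite.op_sub, sub_smul, haa, sub_self]
      rw [← mul_one a, ← c.mul_inv, ← mul_assoc, ← hop, h2, smul_zero]
    refine LinearMap.ext fun x => ?_
    rw [LinearMap.zero_apply, ← hπι' (f x)]
    have := hfa (ι x)
    rw [hπι', h1] at this
    rw [this, map_zero]
  · right
    obtain ⟨c, hc⟩ := isUnit_one_sub_of_mem_jacobson (neg_mem hb)
    -- `a b = e (1 + (a b - e))`, and `1 + (a b - e)` is a unit.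
    have h2 : a * b * (↑c⁻¹ : R) = ei := by
      have h3 : a * b = ei * c := by
        rw [hc, sub_neg_eq_add, mul_add, mul_one, mul_sub, ← mul_assoc, hea, hi.idem.eq,
          add_sub_cancel]
      rw [h3, mul_assoc, c.mul_inv, mul_one]
    have h1 : ∀ x : P, MulOpposite.op a • x = MulOpposite.op ei • x := by
      intro x
      rw [← hae, ← h2]
      have h4 : a * (a * b * (↑c⁻¹ : R)) = a * a * (b * ↑c⁻¹) := by simp only [mul_assoc]
      rw [h4, mul_assoc a b, ← hop, haa, hop]
    refine LinearMap.ext fun x => ?_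
    rw [LinearMap.id_apply, ← hπι' (f x)]
    have := hfa (ι x)
    rw [hπι', h1, ← hιπ, hπι'] at this
    rw [this, hπι']

end Indecomposable

/-! ### Endomorphisms of modules induced from sums of principal projective modules -/

section SumLeftIdeals

variable {A R : Type*} [Ring A] [Ring R] [Module Rᵐᵒᵖ A] [SMulCommClass A Rᵐᵒᵖ A]
  {n : ℕ} (e : Fin n → R) (X : Set (Fin n))

/-- The idempotent `eᵢ` as an element of the summand `R eᵢ` of `⨁ R eᵢ`. -/
def sumGenerator (i : X) : sumLeftIdeals e X :=
  DirectSum.of (fun i : X => leftIdeal (e i)) i ⟨e i, Submodule.mem_span_singleton_self _⟩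

variable {e X}

theorem smul_sumGenerator (he : ∀ i, IsIdempotentElem (e i)) (i : X) (s : leftIdeal (e i)) :
    (s : R) • sumGenerator e X i = DirectSum.of (fun i : X => leftIdeal (e i)) i s := by
  rw [sumGenerator, ← DirectSum.lof_eq_of R, ← map_smul, DirectSum.lof_eq_of]
  congr 1
  exact Subtype.ext ((mem_leftIdeal_iff (he i)).mp s.2)

theorem induced_sumLeftIdeals_ext {N : Type*} [AddCommGroup N] [Module A N]
    {f g : BimoduleTensor A R A (sumLeftIdeals e X) →ₗ[A] N}
    (h : ∀ (i : X) (s : leftIdeal (e i)),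
      f (bimoduleTmul A R 1 (DirectSum.of (fun i : X => leftIdeal (e i)) i s)) =
        g (bimoduleTmul A R 1 (DirectSum.of (fun i : X => leftIdeal (e i)) i s))) : f = g := by
  have : f.toAddMonoidHom.comp (tmulRight A R A (sumLeftIdeals e X) 1) =
      g.toAddMonoidHom.comp (tmulRight A R A (sumLeftIdeals e X) 1) :=
    DirectSum.addHom_ext h
  exact inducedHom_ext fun m => DFunLike.congr_fun this m

/-- Given a self-map `τ` of the index set and elements `zᵢ` of `A`, there is an endomorphism of
`A ⊗ (⨁ R eᵢ)` that maps `1 ⊗ s` to `s zᵢ ⊗ e_{τ i}` for `s ∈ R eᵢ`. -/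
theorem exists_sumHom (τ : X → X) (z : X → A) :
    ∃ F : BimoduleTensor A R A (sumLeftIdeals e X) →ₗ[A] BimoduleTensor A R A (sumLeftIdeals e X),
      ∀ (i : X) (s : leftIdeal (e i)),
        F (bimoduleTmul A R 1 (DirectSum.of (fun i : X => leftIdeal (e i)) i s)) =
          bimoduleTmul A R (rightElt A (s : R) * z i) (sumGenerator e X (τ i)) := by
  let φ : ∀ i : X, leftIdeal (e i) →+ BimoduleTensor A R A (sumLeftIdeals e X) := fun i =>
    { toFun := fun s => bimoduleTmul A R (rightElt A (s : R) * z i) (sumGenerator e X (τ i))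
      map_zero' := by simp [rightElt, zero_bimoduleTmul]
      map_add' := fun s t => by
        rw [Submodule.coe_add, rightElt_add, add_mul, add_bimoduleTmul] }
  obtain ⟨F, hF⟩ := exists_inducedHom (A := A) (R := R) (M := sumLeftIdeals e X)
    (N := BimoduleTensor A R A (sumLeftIdeals e X)) (DirectSum.toAddMonoid φ) fun r m => by
      induction m using DirectSum.induction_on with
      | zero => rw [smul_zero, map_zero, smul_zero]
      | add x y hx hy => rw [smul_add, map_add, map_add, smul_add, hx, hy]
      | of i s =>
        rw [← DirectSum.lof_eq_of R, ← map_smul, DirectSum.lof_eq_of, DirectSum.lof_eq_of,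
          DirectSum.toAddMonoid_of, DirectSum.toAddMonoid_of]
        change bimoduleTmul A R (rightElt A (r * (s : R)) * z i) _ =
          rightElt A r • bimoduleTmul A R _ _
        rw [rightElt_mul, mul_assoc]; rfl
  exact ⟨F, fun i s => by rw [hF, DirectSum.toAddMonoid_of]; rfl⟩

theorem sumHom_comp_eq_id (he : ∀ i, IsIdempotentElem (e i)) {τ τ' : X → X} {z z' : X → A}
    {F F' : BimoduleTensor A R A (sumLeftIdeals e X) →ₗ[A]
      BimoduleTensor A R A (sumLeftIdeals e X)}
    (hF : ∀ (i : X) (s : leftIdeal (e i)),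
      F (bimoduleTmul A R 1 (DirectSum.of (fun i : X => leftIdeal (e i)) i s)) =
        bimoduleTmul A R (rightElt A (s : R) * z i) (sumGenerator e X (τ i)))
    (hF' : ∀ (i : X) (s : leftIdeal (e i)),
      F' (bimoduleTmul A R 1 (DirectSum.of (fun i : X => leftIdeal (e i)) i s)) =
        bimoduleTmul A R (rightElt A (s : R) * z' i) (sumGenerator e X (τ' i)))
    (hτ : ∀ i, τ' (τ i) = i)
    (hz : ∀ i, z i * rightElt A (e (τ i)) * z' (τ i) = rightElt A (e i)) :
    F' ∘ₗ F = LinearMap.id := by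
  refine induced_sumLeftIdeals_ext fun i s => ?_
  have hs : (s : R) * e i = s := (mem_leftIdeal_iff (he i)).mp s.2
  rw [LinearMap.comp_apply, hF, tmul_eq_smul, map_smul, sumGenerator, hF', hτ, smul_bimoduleTmul]
  have h1 : (rightElt A (s : R) * z i) •
      (rightElt A (e (τ i)) * z' (τ i)) = rightElt A (s : R) := by
    rw [smul_eq_mul, mul_assoc, ← mul_assoc (z i), hz, ← rightElt_mul, hs]
  rw [h1, tmul_eq_smul, rightElt_smul_tmul, smul_sumGenerator he]
  rfl

variable {G : Type*} [Group G] (𝒜 : RingGrading G A) [RightStable 𝒜 R]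

theorem sumHom_mem_comp {g : G} {τ : X → X} {z : X → A} (hz : ∀ i, z i ∈ 𝒜.comp g)
    {F : BimoduleTensor A R A (sumLeftIdeals e X) →ₗ[A] BimoduleTensor A R A (sumLeftIdeals e X)}
    (hF : ∀ (i : X) (s : leftIdeal (e i)),
      F (bimoduleTmul A R 1 (DirectSum.of (fun i : X => leftIdeal (e i)) i s)) =
        bimoduleTmul A R (rightElt A (s : R) * z i) (sumGenerator e X (τ i))) (k : G)
    (x : BimoduleTensor A R A (sumLeftIdeals e X))
    (hx : x ∈ (inducedGrading 𝒜 R (sumLeftIdeals e X)).comp k) :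
    F x ∈ (inducedGrading 𝒜 R (sumLeftIdeals e X)).comp (k * g) := by
  refine map_mem_inducedComp 𝒜 (fun m => ?_) k x hx
  change (F.toAddMonoidHom.comp (tmulRight A R A (sumLeftIdeals e X) 1)) m ∈ _
  induction m using DirectSum.induction_on with
  | zero => rw [map_zero]; exact zero_mem _
  | add x y hx hy => rw [map_add]; exact add_mem hx hy
  | of i s =>
    change F (bimoduleTmul A R 1 (DirectSum.of (fun i : X => leftIdeal (e i)) i s)) ∈ _
    rw [hF]
    refine tmul_mem_inducedComp 𝒜 ?_ _
    have := 𝒜.mul_mem (RightStable.smul_mem 1 (s : R) 1 𝒜.one_mem) (hz i)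
    rwa [one_mul] at this

end SumLeftIdeals

namespace RingGrading

variable {G : Type w} {A : Type u} [Group G] [Ring A] {𝒜 : RingGrading G A} {ε : G → A}

/-! ### The homogeneous components as bimodules -/

/-- The product of two homogeneous elements of inverse degrees, as an element of `A_1`. -/
def baseMul {g h : G} (hgh : g * h = 1) (x : 𝒜.comp g) (y : 𝒜.comp h) : 𝒜.base :=
  ⟨x * y, by
    have := 𝒜.mul_mem x.2 y.2
    rwa [hgh] at this⟩

theorem IsEpsilonStrong.exists_left_basis (hε : 𝒜.IsEpsilonStrong ε) (g : G) :
    ∃ (n : ℕ) (a : Fin n → 𝒜.comp g⁻¹) (b : Fin n → 𝒜.comp g),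
      ∀ x : 𝒜.comp g, ∑ k, baseMul (mul_inv_cancel g) x (a k) • b k = x := by
  obtain ⟨n, a, b, ha, hb, h⟩ := hε.exists_sum g⁻¹
  refine ⟨n, fun k => ⟨a k, ha k⟩, fun k => ⟨b k, inv_inv g ▸ hb k⟩, fun x => Subtype.ext ?_⟩
  rw [AddSubgroup.val_finsetSum]
  change ∑ k, (x : A) * a k * b k = x
  simp only [mul_assoc]
  rw [← Finset.mul_sum, ← h, hε.right_unital g x x.2]

theorem IsEpsilonStrong.exists_right_basis (hε : 𝒜.IsEpsilonStrong ε) (g : G) :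
    ∃ (n : ℕ) (a : Fin n → 𝒜.comp g) (b : Fin n → 𝒜.comp g⁻¹),
      ∀ x : 𝒜.comp g, ∑ k, MulOpposite.op (baseMul (inv_mul_cancel g) (b k) x) • a k = x := by
  obtain ⟨n, a, b, ha, hb, h⟩ := hε.exists_sum g
  refine ⟨n, fun k => ⟨a k, ha k⟩, fun k => ⟨b k, hb k⟩, fun x => Subtype.ext ?_⟩
  rw [AddSubgroup.val_finsetSum]
  change ∑ k, a k * (b k * (x : A)) = x
  simp only [← mul_assoc]
  rw [← Finset.sum_mul, ← h, hε.left_unital g x x.2]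

/-- The components of an epsilon-strongly graded ring are partially invertible bimodules: a
decomposition of the local identity provides dual bases on both sides. -/
theorem IsEpsilonStrong.isPartiallyInvertible (hε : 𝒜.IsEpsilonStrong ε) (g : G) :
    IsPartiallyInvertible 𝒜.base (𝒜.comp g) := by
  obtain ⟨n, a, b, hab⟩ := hε.exists_left_basis g
  obtain ⟨m, c, d, hcd⟩ := hε.exists_right_basis g
  let s : 𝒜.comp g →ₗ[𝒜.base] (Fin n → 𝒜.base) :=
    { toFun := fun x k => baseMul (mul_inv_cancel g) x (a k)
      map_add' := fun x y => by ext k; exact add_mul (x : A) y (a k)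
      map_smul' := fun r x => by ext k; exact mul_assoc (r : A) x (a k) }
  let s' : 𝒜.comp g →ₗ[(𝒜.base)ᵐᵒᵖ] (Fin m → (𝒜.base)ᵐᵒᵖ) :=
    { toFun := fun x k => MulOpposite.op (baseMul (inv_mul_cancel g) (d k) x)
      map_add' := fun x y => by
        ext k
        exact congrArg MulOpposite.op (Subtype.ext (mul_add (d k : A) x y))
      map_smul' := fun r x => by
        ext k
        exact congrArg MulOpposite.op (Subtype.ext (mul_assoc (d k : A) x (r.unop : A)).symm) }
  have hs : Fintype.linearCombination 𝒜.base b ∘ₗ s = LinearMap.id := LinearMap.ext hab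
  have hs' : Fintype.linearCombination (𝒜.base)ᵐᵒᵖ c ∘ₗ s' = LinearMap.id := LinearMap.ext hcd
  refine ⟨.of_surjective _ (LinearMap.surjective_of_comp_eq_id _ _ hs), .of_split _ _ hs,
    .of_surjective _ (LinearMap.surjective_of_comp_eq_id _ _ hs'), .of_split _ _ hs',
    fun f => ⟨∑ k, baseMul (mul_inv_cancel g) (f (c k)) (d k), fun x => ?_⟩,
    fun f => ⟨∑ k, baseMul (inv_mul_cancel g) (a k) (f (b k)), fun x => ?_⟩⟩
  · conv_lhs => rw [← hcd x, map_sum]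
    simp only [map_smul]
    rw [Finset.sum_smul]
    exact Finset.sum_congr rfl fun k _ => Subtype.ext (mul_assoc (f (c k) : A) (d k) x).symm
  · conv_lhs => rw [← hab x, map_sum]
    simp only [map_smul]
    rw [Finset.op_sum, Finset.sum_smul]
    exact Finset.sum_congr rfl fun k _ => Subtype.ext (mul_assoc (x : A) (a k) (f (b k)))

variable (𝒜) in
theorem exists_compTensor_mul (g : G) (e : 𝒜.base) :
    ∃ F : 𝒜.compTensor g (leftIdeal e) →+ A, ∀ a (r : leftIdeal e),
      F (bimoduleTmul 𝒜.base 𝒜.base a r) = a * ((r : 𝒜.base) : A) := by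
  obtain ⟨F, hF⟩ := exists_bimoduleLift 𝒜.base (R := 𝒜.base) (P := 𝒜.comp g) (M := leftIdeal e)
    { toFun := fun a =>
        { toFun := fun r => (a : A) * ((r : 𝒜.base) : A)
          map_zero' := mul_zero _
          map_add' := fun r s => mul_add (a : A) ((r : 𝒜.base) : A) ((s : 𝒜.base) : A) }
      map_zero' := by ext r; exact zero_mul _
      map_add' := fun a b => by ext r; exact add_mul (a : A) b _ }
    (fun a r s => mul_assoc (a : A) r ((s : 𝒜.base) : A))
  exact ⟨F, hF⟩

/-! ### Idempotents equivalent through homogeneous elements -/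

variable (𝒜) in
/-- The idempotents `e` and `f` of `A_1` are equivalent through elements of degree `g`: there are
`x ∈ f A_g e` and `y ∈ e A_{g⁻¹} f` with `x y = f` and `y x = e`. -/
def HomogeneousEquiv (g : G) (e f : 𝒜.base) : Prop :=
  ∃ x ∈ 𝒜.comp g, ∃ y ∈ 𝒜.comp g⁻¹, x * y = f ∧ y * x = e ∧ x * e = x ∧ y * f = y

namespace HomogeneousEquiv

variable {g h : G} {e f k : 𝒜.base}

theorem refl (he : IsIdempotentElem e) : 𝒜.HomogeneousEquiv 1 e e := by
  have h : (e : A) * e = e := congrArg Subtype.val he.eq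
  exact ⟨e, e.2, e, by rw [inv_one]; exact e.2, h, h, h, h⟩

theorem symm (hef : 𝒜.HomogeneousEquiv g e f) : 𝒜.HomogeneousEquiv g⁻¹ f e := by
  obtain ⟨x, hx, y, hy, h1, h2, h3, h4⟩ := hef
  exact ⟨y, hy, x, by rwa [inv_inv], h2, h1, h4, h3⟩

theorem trans (hef : 𝒜.HomogeneousEquiv h e f) (hfk : 𝒜.HomogeneousEquiv g f k) :
    𝒜.HomogeneousEquiv (g * h) e k := by
  obtain ⟨x, hx, y, hy, h1, h2, h3, h4⟩ := hef
  obtain ⟨x', hx', y', hy', h1', h2', h3', h4'⟩ := hfk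
  refine ⟨x' * x, 𝒜.mul_mem hx' hx, y * y', by rw [mul_inv_rev]; exact 𝒜.mul_mem hy hy',
    ?_, ?_, by rw [mul_assoc, h3], by rw [mul_assoc, h4']⟩
  · rw [mul_assoc, ← mul_assoc x, h1, ← mul_assoc, h3', h1']
  · rw [mul_assoc, ← mul_assoc y', h2', ← mul_assoc, h4, h2]

theorem unit_mul (hε : 𝒜.IsEpsilonStrong ε) (hef : 𝒜.HomogeneousEquiv g e f) :
    ε g * (f : A) = f := by
  obtain ⟨x, hx, y, hy, h1, -⟩ := hef
  rw [← h1, ← mul_assoc, hε.left_unital g x hx]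

/-- Right multiplication by `y`, with inverse induced by `x`, identifies `A_g ⊗ R e` and `R f`. -/
theorem nonempty_equiv (he : IsIdempotentElem e) (hf : IsIdempotentElem f)
    (hef : 𝒜.HomogeneousEquiv g e f) :
    Nonempty (𝒜.compTensor g (leftIdeal e) ≃ₗ[𝒜.base] leftIdeal f) := by
  obtain ⟨x, hx, y, hy, h1, h2, h3, h4⟩ := hef
  let e' : leftIdeal e := ⟨e, Submodule.mem_span_singleton_self e⟩
  have hr : ∀ r : leftIdeal e, (r : 𝒜.base) * e = r := fun r => (mem_leftIdeal_iff he).mp r.2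
  have hr' : ∀ r : leftIdeal e, ((r : 𝒜.base) : A) * e = (r : 𝒜.base) := fun r =>
    congrArg Subtype.val (hr r)
  have hmem : ∀ (a : 𝒜.comp g) (r : 𝒜.base), (a : A) * r * y ∈ 𝒜.comp 1 := fun a r => by
    simpa using 𝒜.mul_mem (𝒜.mul_mem (h := 1) a.2 r.2) hy
  obtain ⟨F, hF⟩ : ∃ F : 𝒜.compTensor g (leftIdeal e) →ₗ[𝒜.base] leftIdeal f,
      ∀ a (r : leftIdeal e), ((F (bimoduleTmul 𝒜.base 𝒜.base a r) : 𝒜.base) : A) =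
        (a : A) * (r : 𝒜.base) * y := by
    obtain ⟨F, hF⟩ := exists_bimoduleLift_linear (S := 𝒜.base) (R := 𝒜.base) (P := 𝒜.comp g)
      (M := leftIdeal e) (N := leftIdeal f)
      { toFun := fun a =>
          { toFun := fun r => ⟨⟨(a : A) * (r : 𝒜.base) * y, hmem a r⟩, by
              rw [mem_leftIdeal_iff hf]
              apply Subtype.ext
              change (a : A) * (r : 𝒜.base) * y * f = _
              rw [mul_assoc, h4]⟩
            map_zero' := by
              apply Subtype.ext; apply Subtype.ext
              change (a : A) * 0 * y = 0
              rw [mul_zero, zero_mul]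
            map_add' := fun r s => by
              apply Subtype.ext; apply Subtype.ext
              change (a : A) * ((r : 𝒜.base) + (s : 𝒜.base)) * y =
                (a : A) * (r : 𝒜.base) * y + a * (s : 𝒜.base) * y
              rw [mul_add, add_mul] }
        map_add' := fun a b => by
          ext r
          change ((a : A) + b) * (r : 𝒜.base) * y = (a : A) * (r : 𝒜.base) * y + b * (r : 𝒜.base) * y
          rw [add_mul, add_mul]
        map_smul' := fun s a => by
          ext r
          change (s : A) * a * (r : 𝒜.base) * y = (s : A) * (a * (r : 𝒜.base) * y)
          simp only [mul_assoc] }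
      (fun a s r => by
        apply Subtype.ext; apply Subtype.ext
        change (a : A) * s * (r : 𝒜.base) * y = a * (s * (r : 𝒜.base)) * y
        simp only [mul_assoc])
    exact ⟨F, fun a r => by rw [hF]; rfl⟩
  let K : leftIdeal f →ₗ[𝒜.base] 𝒜.compTensor g (leftIdeal e) :=
    tmulLeft 𝒜.base 𝒜.base (𝒜.comp g) e' ∘ₗ
      LinearMap.toSpanSingleton 𝒜.base (𝒜.comp g) ⟨x, hx⟩ ∘ₗ (leftIdeal f).subtype
  refine ⟨LinearEquiv.ofLinearMap F K ?_ ?_⟩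
  · ext r
    change ((F (bimoduleTmul 𝒜.base 𝒜.base _ e') : 𝒜.base) : A) = _
    rw [hF]
    change ((r : 𝒜.base) : A) * x * e * y = (r : 𝒜.base)
    rw [mul_assoc _ x, h3, mul_assoc, h1]
    exact congrArg Subtype.val ((mem_leftIdeal_iff hf).mp r.2)
  · refine LinearMap.ext fun t => ?_
    induction t using bimoduleTensor_induction with
    | zero => rw [map_zero, map_zero]
    | add x y hx hy => rw [map_add, map_add, hx, hy]
    | tmul a r =>
      change bimoduleTmul 𝒜.base 𝒜.base _ e' = bimoduleTmul 𝒜.base 𝒜.base a r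
      have h5 : r = (r : 𝒜.base) • e' := Subtype.ext (hr r).symm
      have h6 : bimoduleTmul 𝒜.base 𝒜.base (MulOpposite.op (r : 𝒜.base) • a) e' =
          bimoduleTmul 𝒜.base 𝒜.base a r := by rw [op_smul_bimoduleTmul, ← h5]
      refine Eq.trans ?_ h6
      congr 1
      apply Subtype.ext
      change ((F (bimoduleTmul 𝒜.base 𝒜.base a r) : 𝒜.base) : A) * x = a * (r : 𝒜.base)
      rw [hF, mul_assoc, h2, mul_assoc, hr']

/-- An isomorphism `A_g ⊗ R e ≃ R f` is given by right multiplication by an element of degree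
`g⁻¹`. As `e` is primitive, this element has a two-sided inverse of degree `g`. -/
theorem of_equiv (hε : 𝒜.IsEpsilonStrong ε) (he : IsPrimitiveIdempotent e)
    (hf : IsPrimitiveIdempotent f)
    (Φ : 𝒜.compTensor g (leftIdeal e) ≃ₗ[𝒜.base] leftIdeal f) : 𝒜.HomogeneousEquiv g e f := by
  let e' : leftIdeal e := ⟨e, Submodule.mem_span_singleton_self e⟩
  let W : 𝒜.comp g →ₗ[𝒜.base] 𝒜.base :=
    (leftIdeal f).subtype ∘ₗ Φ.toLinearMap ∘ₗ tmulLeft 𝒜.base 𝒜.base (𝒜.comp g) e'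
  have hW : ∀ c, W c * f = W c := fun c => (mem_leftIdeal_iff hf.idem).mp (Φ _).2
  have hWe : ∀ c, W (MulOpposite.op e • c) = W c := by
    intro c
    change ((Φ (bimoduleTmul 𝒜.base 𝒜.base (MulOpposite.op e • c) e') : leftIdeal f) : 𝒜.base) =
      (Φ (bimoduleTmul 𝒜.base 𝒜.base c e') : leftIdeal f)
    rw [op_smul_bimoduleTmul]
    congr 3
    exact Subtype.ext he.idem.eq
  have hee : (e : A) * e = e := congrArg Subtype.val he.idem.eq
  have hff : (f : A) * f = f := congrArg Subtype.val hf.idem.eq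
  obtain ⟨n, a, b, hab⟩ := hε.exists_left_basis g
  obtain ⟨y₀, hy₀⟩ : ∃ y₀ : A, y₀ = ∑ k, (a k : A) * W (b k) := ⟨_, rfl⟩
  have hy₀m : y₀ ∈ 𝒜.comp g⁻¹ := by
    rw [hy₀]
    refine sum_mem fun k _ => ?_
    have := 𝒜.mul_mem (a k).2 (W (b k)).2
    rwa [mul_one] at this
  have hWy : ∀ c : 𝒜.comp g, (W c : A) = c * y₀ := by
    intro c
    conv_lhs => rw [← hab c, map_sum]
    rw [hy₀, Finset.mul_sum, ← Subring.subtype_apply, map_sum]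
    refine Finset.sum_congr rfl fun k _ => ?_
    rw [map_smul]
    exact mul_assoc (c : A) (a k) (W (b k))
  have hy₀f : y₀ * f = y₀ := by
    rw [hy₀, Finset.sum_mul]
    refine Finset.sum_congr rfl fun k _ => ?_
    rw [mul_assoc]
    exact congrArg _ (congrArg Subtype.val (hW (b k)))
  have hgen : ∀ t : 𝒜.compTensor g (leftIdeal e), ∃ c, t = bimoduleTmul 𝒜.base 𝒜.base c e' := by
    intro t
    induction t using bimoduleTensor_induction with
    | zero => exact ⟨0, (zero_bimoduleTmul _).symm⟩
    | add x y hx hy =>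
      obtain ⟨c, rfl⟩ := hx
      obtain ⟨d, rfl⟩ := hy
      exact ⟨c + d, (add_bimoduleTmul _ _ _).symm⟩
    | tmul c r =>
      refine ⟨MulOpposite.op (r : 𝒜.base) • c, ?_⟩
      rw [op_smul_bimoduleTmul]
      congr 1
      exact Subtype.ext ((mem_leftIdeal_iff he.idem).mp r.2).symm
  obtain ⟨c, hc⟩ := hgen (Φ.symm ⟨f, Submodule.mem_span_singleton_self f⟩)
  have hcf : W c = f := by
    change ((Φ (bimoduleTmul 𝒜.base 𝒜.base c e') : leftIdeal f) : 𝒜.base) = f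
    rw [← hc, Φ.apply_symm_apply]
  have hey : (c : A) * e * (e * y₀) = f := by
    rw [mul_assoc, ← mul_assoc (e : A), hee, ← mul_assoc, ← hcf, ← hWe c, hWy]
    rfl
  have hxm : (f : A) * (c * e) ∈ 𝒜.comp g := by
    simpa using 𝒜.mul_mem (g := 1) f.2 (𝒜.mul_mem (h := 1) c.2 e.2)
  have hym : (e : A) * y₀ ∈ 𝒜.comp g⁻¹ := by
    simpa using 𝒜.mul_mem (g := 1) e.2 hy₀m
  have hxy : (f : A) * (c * e) * (e * y₀) = f := by rw [mul_assoc, hey, hff]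
  have hyf : (e : A) * y₀ * f = e * y₀ := by rw [mul_assoc, hy₀f]
  refine ⟨f * (c * e), hxm, e * y₀, hym, hxy, ?_, by simp only [mul_assoc, hee], hyf⟩
  -- `y x` is a nonzero idempotent of `eRe`.
  obtain ⟨p, hp⟩ : ∃ p : 𝒜.base, (p : A) = e * y₀ * (f * (c * e)) :=
    ⟨baseMul (inv_mul_cancel g) ⟨_, hym⟩ ⟨_, hxm⟩, rfl⟩
  rw [← hp]
  have hpp : p * p = p := by
    apply Subtype.ext
    rw [Subring.coe_mul, hp, ← mul_assoc, mul_assoc (e * y₀) _ (e * y₀), hxy, hyf]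
  have hep : e * p = p := by
    apply Subtype.ext
    rw [Subring.coe_mul, hp, ← mul_assoc, ← mul_assoc (e : A) e, hee]
  have hpe : p * e = p := by
    apply Subtype.ext
    rw [Subring.coe_mul, hp]
    simp only [mul_assoc, hee]
  refine congrArg Subtype.val ((he.eq_zero_or_eq hpp hep hpe).resolve_left fun h0 => ?_)
  rw [h0, ZeroMemClass.coe_zero] at hp
  refine hf.ne_zero (Subtype.ext ?_)
  calc (f : A) = f * (c * e) * (e * y₀) * (f * (c * e) * (e * y₀)) := by rw [hxy, hff]
    _ = f * (c * e) * ((e * y₀) * (f * (c * e))) * (e * y₀) := by simp only [mul_assoc]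
    _ = 0 := by rw [← hp, mul_zero, zero_mul]

theorem nonempty_equiv_of_one (he : IsIdempotentElem e) (hf : IsIdempotentElem f)
    (hef : 𝒜.HomogeneousEquiv 1 e f) : Nonempty (leftIdeal e ≃ₗ[𝒜.base] leftIdeal f) := by
  obtain ⟨φ⟩ := hef.nonempty_equiv he hf
  obtain ⟨ψ⟩ := (refl he).nonempty_equiv (𝒜 := 𝒜) he he
  exact ⟨ψ.symm.trans φ⟩

end HomogeneousEquiv

/-! ### The stabilizer of a set of principal projective modules -/

section Stabilizer

variable {n : ℕ} {e : Fin n → 𝒜.base}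

theorem mem_stableSet_iff (hε : 𝒜.IsEpsilonStrong ε) (he : IsBasicSet e) {X : Set (Fin n)} {g : G} :
    g ∈ 𝒜.stableSet e X ↔ ∀ i ∈ X, ∃ j ∈ X, 𝒜.HomogeneousEquiv g (e i) (e j) := by
  refine forall₂_congr fun i _ => exists_congr fun j => and_congr_right fun _ => ⟨?_, ?_⟩
  · rintro ⟨Φ⟩
    exact .of_equiv hε (he.primitive i) (he.primitive j) Φ
  · exact fun h => h.nonempty_equiv (he.primitive i).idem (he.primitive j).idem

theorem HomogeneousEquiv.eq_of_eq (he : IsBasicSet e) {g : G} {i j k : Fin n}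
    (hik : 𝒜.HomogeneousEquiv g (e i) (e k)) (hjk : 𝒜.HomogeneousEquiv g (e j) (e k)) : i = j := by
  have h := hik.trans hjk.symm
  rw [inv_mul_cancel] at h
  exact he.irredundant i j (h.nonempty_equiv_of_one (he.primitive i).idem (he.primitive j).idem)

/-- An element of the stabilizer permutes `X`. -/
theorem exists_perm_of_mem_stableSet (hε : 𝒜.IsEpsilonStrong ε) (he : IsBasicSet e)
    {X : Set (Fin n)} {g : G} (hg : g ∈ 𝒜.stableSet e X) :
    ∃ σ : X ≃ X, ∀ i : X, 𝒜.HomogeneousEquiv g (e i) (e (σ i)) := by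
  rw [mem_stableSet_iff hε he] at hg
  choose! σ hσX hσ using hg
  let τ : X → X := fun i => ⟨σ i, hσX i i.2⟩
  have hτ : Function.Injective τ := fun i j hij => by
    have h1 := hσ i i.2
    rw [show σ i = σ j from congrArg Subtype.val hij] at h1
    exact Subtype.ext (h1.eq_of_eq he (hσ j j.2))
  exact ⟨Equiv.ofBijective τ (Finite.injective_iff_bijective.mp hτ), fun i => hσ i i.2⟩

theorem inv_mem_stableSet (hε : 𝒜.IsEpsilonStrong ε) (he : IsBasicSet e)
    {X : Set (Fin n)} {g : G} (hg : g ∈ 𝒜.stableSet e X) : g⁻¹ ∈ 𝒜.stableSet e X := by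
  obtain ⟨σ, hσ⟩ := exists_perm_of_mem_stableSet hε he hg
  rw [mem_stableSet_iff hε he]
  intro j hj
  refine ⟨σ.symm ⟨j, hj⟩, (σ.symm ⟨j, hj⟩).2, ?_⟩
  have := (hσ (σ.symm ⟨j, hj⟩)).symm
  rwa [σ.apply_symm_apply] at this

/-- The set `G_X` as a subgroup of `G`. -/
def stabilizer (hε : 𝒜.IsEpsilonStrong ε) (he : IsBasicSet e) (X : Set (Fin n)) : Subgroup G where
  carrier := 𝒜.stableSet e X
  one_mem' := by
    rw [mem_stableSet_iff hε he]
    exact fun i hi => ⟨i, hi, .refl (he.primitive i).idem⟩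
  mul_mem' := by
    intro g h hg hh
    rw [mem_stableSet_iff hε he] at hg hh ⊢
    intro i hi
    obtain ⟨j, hj, hij⟩ := hh i hi
    obtain ⟨k, hk, hjk⟩ := hg j hj
    exact ⟨k, hk, hij.trans hjk⟩
  inv_mem' := inv_mem_stableSet hε he

theorem IsEpsilonStrong.restrict (hε : 𝒜.IsEpsilonStrong ε) (H : Subgroup G) :
    ∃ ε' : H → 𝒜.sub H, (𝒜.restrict H).IsEpsilonStrong ε' := by
  have hl : ∀ h : H, ∀ a ∈ (𝒜.restrict H).comp h,
      (⟨ε h, 𝒜.base_le_sub H (hε.mem_one h)⟩ : 𝒜.sub H) * a = a :=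
    fun h a ha => Subtype.ext (hε.left_unital h a ha)
  have hr : ∀ h : H, ∀ a ∈ (𝒜.restrict H).comp h⁻¹,
      a * (⟨ε h, 𝒜.base_le_sub H (hε.mem_one h)⟩ : 𝒜.sub H) = a := fun h a ha =>
    Subtype.ext (by simpa using hε.right_unital (h : G)⁻¹ a ha)
  refine ⟨fun h => ⟨ε h, 𝒜.base_le_sub H (hε.mem_one h)⟩, fun h => ?_, fun h x hx => ?_, hl,
    fun h a ha => hr h⁻¹ a (by rwa [inv_inv])⟩
  · obtain ⟨n, a, b, ha, hb, hab⟩ := hε.exists_sum (h : G)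
    have h1 : (⟨ε h, 𝒜.base_le_sub H (hε.mem_one h)⟩ : 𝒜.sub H) =
        ∑ k, (⟨a k, 𝒜.comp_le_sub H h (ha k)⟩ : 𝒜.sub H) *
          ⟨b k, 𝒜.comp_le_sub H h⁻¹ (hb k)⟩ := by
      apply Subtype.ext
      rw [← Subring.subtype_apply, ← Subring.subtype_apply, map_sum]
      exact hab
    rw [h1]
    exact sum_mem fun k _ => AddSubgroup.subset_closure ⟨_, ha k, _, hb k, rfl⟩
  · induction hx using AddSubgroup.closure_induction with
    | mem x hx =>
      obtain ⟨a, ha, b, hb, rfl⟩ := hx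
      exact ⟨by rw [← mul_assoc, hl h a ha], by rw [mul_assoc, hr h b hb]⟩
    | zero => simp
    | add x y _ _ hx hy => exact ⟨by rw [mul_add, hx.1, hy.1], by rw [add_mul, hx.2, hy.2]⟩
    | neg x _ hx => exact ⟨by rw [mul_neg, hx.1], by rw [neg_mul, hx.2]⟩

/-- Every `h` in the stabilizer `H` of `X` permutes `X`, and the elements of degree `h` and `h⁻¹`
that realize the permutation assemble to an automorphism of degree `h` of `A_H ⊗ Q_X`. -/
theorem isPartialCrossedProduct_stabilizer (hε : 𝒜.IsEpsilonStrong ε) (he : IsBasicSet e)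
    (X : Set (Fin n)) : IsPartialCrossedProduct (inducedGrading
      (𝒜.restrict (stabilizer hε he X)) 𝒜.base (sumLeftIdeals e X)).endGrading := by
  set H := stabilizer hε he X
  refine ModuleGrading.isPartialCrossedProduct_endGrading _ fun h => Or.inr ?_
  obtain ⟨σ, hσ⟩ := exists_perm_of_mem_stableSet hε he (X := X) h.2
  choose x hx y hy hxy hyx hxe hyf using hσ
  have hidem : ∀ i, IsIdempotentElem (e i) := fun i => (he.primitive i).idem
  have hcoe : ∀ r : 𝒜.base, (rightElt (𝒜.sub H) r : A) = r := fun r => one_mul _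
  let x' : X → 𝒜.sub H := fun i => ⟨x (σ.symm i), 𝒜.comp_le_sub H h (hx _)⟩
  let y' : X → 𝒜.sub H := fun i => ⟨y i, 𝒜.comp_le_sub H h⁻¹ (hy _)⟩
  obtain ⟨U, hU⟩ := exists_sumHom (A := 𝒜.sub H) (e := e) σ.symm x'
  obtain ⟨V, hV⟩ := exists_sumHom (A := 𝒜.sub H) (e := e) σ y'
  have hVU : V ∘ₗ U = LinearMap.id := by
    refine sumHom_comp_eq_id hidem hU hV σ.apply_symm_apply fun i => Subtype.ext ?_
    rw [Subring.coe_mul, Subring.coe_mul, hcoe, hcoe]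
    change x (σ.symm i) * _ * y (σ.symm i) = _
    rw [hxe, hxy, σ.apply_symm_apply]
  have hUV : U ∘ₗ V = LinearMap.id := by
    refine sumHom_comp_eq_id hidem hV hU σ.symm_apply_apply fun i => Subtype.ext ?_
    rw [Subring.coe_mul, Subring.coe_mul, hcoe, hcoe]
    change y i * _ * x (σ.symm (σ i)) = _
    rw [hyf, σ.symm_apply_apply, hyx]
  exact ⟨LinearEquiv.ofLinearMap U V hUV hVU,
    sumHom_mem_comp (𝒜.restrict H) (g := h) (fun i => hx (σ.symm i)) hU⟩

theorem unit_mul_eq_of_mem_stableSet (hε : 𝒜.IsEpsilonStrong ε) (he : IsBasicSet e) {g : G}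
    (hg : g ∈ 𝒜.stableSet e Set.univ) (i : Fin n) : ε g * (e i : A) = e i := by
  obtain ⟨σ, hσ⟩ := exists_perm_of_mem_stableSet hε he hg
  have := hσ (σ.symm ⟨i, trivial⟩)
  rw [σ.apply_symm_apply] at this
  exact this.unit_mul hε

theorem mem_stableSet_of_unit_mul_ne_zero (hε : 𝒜.IsEpsilonStrong ε) (hR : IsSemiperfectRing 𝒜.base)
    (he : IsBasicSet e) {g : G} (hg : ∀ i, ε g * (e i : A) ≠ 0) :
    g ∈ 𝒜.stableSet e Set.univ := by
  rw [← inv_inv g]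
  refine inv_mem_stableSet hε he fun i _ => ?_
  rcases (hε.isPartiallyInvertible g⁻¹).subsingleton_or_equiv hR he i with h | ⟨j, h⟩
  · exfalso
    obtain ⟨F, hF⟩ := exists_compTensor_mul 𝒜 g⁻¹ (e i)
    refine hg i (hε.unit_smul_eq_zero (N := A) fun b hb => ?_)
    have h1 := hF ⟨b, hb⟩ ⟨e i, Submodule.mem_span_singleton_self _⟩
    rw [Subsingleton.elim (bimoduleTmul _ _ _ _) 0, map_zero] at h1
    exact h1.symm
  · exact ⟨j, trivial, h⟩

end Stabilizer

end RingGrading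

theorem IsProgenerator.gradedEquivalent {G : Type w} {A : Type u} {R : Type v} {M : Type*} [Group G]
    [Ring A] (𝒜 : RingGrading G A) [Ring R] [Module Rᵐᵒᵖ A] [SMulCommClass A Rᵐᵒᵖ A]
    [RightStable 𝒜 R] [AddCommGroup M] [Module R M] (hM : IsProgenerator R M) :
    GradedEquivalent 𝒜 (inducedGrading 𝒜 R M).endGrading :=
  ⟨_, _, _, inducedGrading 𝒜 R M, hM.induced, RingEquiv.refl _, fun _ _ => Iff.rfl⟩

theorem theorem6 {G : Type w} [Group G] {A : Type u} [Ring A] (𝒜 : RingGrading G A)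
    (ε : G → A) (hε : 𝒜.IsEpsilonStrong ε)
    (hR : IsSemiperfectRing 𝒜.base) {n : ℕ} (e : Fin n → 𝒜.base) (he : IsBasicSet e) :
    -- (i)
    (∀ (P : Type v) [AddCommGroup P] [Module 𝒜.base P],
      IsProgenerator 𝒜.base P → 𝒜.IsInvariantModule P →
        IsPartialCrossedProduct (inducedGrading 𝒜 𝒜.base P).endGrading ∧
        GradedEquivalent 𝒜 (inducedGrading 𝒜 𝒜.base P).endGrading) ∧
    -- (ii)
    (∀ (P : Type v) [AddCommGroup P] [Module 𝒜.base P] [Module (𝒜.base)ᵐᵒᵖ P]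
      [SMulCommClass 𝒜.base (𝒜.base)ᵐᵒᵖ P], IsPartiallyInvertible 𝒜.base P → ∀ i : Fin n,
        Subsingleton (BimoduleTensor 𝒜.base 𝒜.base P (leftIdeal (e i))) ∨
        ∃ j : Fin n, Nonempty (BimoduleTensor 𝒜.base 𝒜.base P (leftIdeal (e i))
          ≃ₗ[𝒜.base] leftIdeal (e j))) ∧
    -- (iii)
    (∀ X : Set (Fin n), X.Nonempty → ∃ H : Subgroup G, (H : Set G) = 𝒜.stableSet e X ∧
      (∃ ε' : H → 𝒜.sub H, (𝒜.restrict H).IsEpsilonStrong ε') ∧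
      IsPartialCrossedProduct
        (inducedGrading (𝒜.restrict H) 𝒜.base (sumLeftIdeals e X)).endGrading) ∧
    -- (iv)
    (𝒜.stableSet e Set.univ = {g | ∀ i, ε g * (e i : A) = e i} ∧
      𝒜.stableSet e Set.univ = {g | ∀ i, ε g * (e i : A) ≠ 0}) ∧
    -- (v)
    (∃ H : Subgroup G, (H : Set G) = 𝒜.stableSet e Set.univ ∧
      (∃ ε' : H → 𝒜.sub H, (𝒜.restrict H).IsEpsilonStrong ε') ∧
      IsPartialCrossedProduct
        (inducedGrading (𝒜.restrict H) 𝒜.base (sumLeftIdeals e Set.univ)).endGrading ∧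
      GradedEquivalent (𝒜.restrict H)
        (inducedGrading (𝒜.restrict H) 𝒜.base (sumLeftIdeals e Set.univ)).endGrading) := by
  refine ⟨fun P _ _ hP hinv => ⟨RingGrading.isPartialCrossedProduct_of_isInvariantModule hε hinv,
      hP.gradedEquivalent 𝒜⟩,
    fun P _ _ _ _ hP i => hP.subsingleton_or_equiv hR he i,
    fun X _ => ⟨RingGrading.stabilizer hε he X, rfl, hε.restrict _,
      RingGrading.isPartialCrossedProduct_stabilizer hε he X⟩,
    ⟨?_, ?_⟩,
    RingGrading.stabilizer hε he Set.univ, rfl, hε.restrict _,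
    RingGrading.isPartialCrossedProduct_stabilizer hε he Set.univ,
    (he.isProgenerator hR).gradedEquivalent _⟩
  · refine Set.Subset.antisymm (fun g => RingGrading.unit_mul_eq_of_mem_stableSet hε he)
      fun g hg => RingGrading.mem_stableSet_of_unit_mul_ne_zero hε hR he fun i h => ?_
    rw [hg i] at h
    exact (he.primitive i).ne_zero (Subtype.ext h)
  · refine Set.Subset.antisymm (fun g hg i h => ?_)
      fun g => RingGrading.mem_stableSet_of_unit_mul_ne_zero hε hR he
    rw [RingGrading.unit_mul_eq_of_mem_stableSet hε he hg i] at h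
    exact (he.primitive i).ne_zero (Subtype.ext h)
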